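/- Let $n\ge 1$ and let $\mathbb H^n$ be the $n$-dimensional hyperbolic space of constant curvature $-1$ (with $\mathbb H^1=\mathbb R$). For a positive $C^2$ function $f$ on an open set $\Omega\subset\mathbb H^n$, call $f$ strictly $\lambda$-log-concave on $\Omega$ if at every point of $\Omega$ the matrix \[\bigl(-(\log f)_{ij}-\lambda\,|\nabla\log f|\,\delta_{ij}\bigr)\] is positive definite, where $(\log f)_{ij}$ are the components of the Riemannian Hessian of $\log f$ in an orthonormal frame. The first Dirichlet eigenfunction of a bounded domain $\Omega$ is a function $v\in C^2(\Omega)\cap C^0(\overline\Omega)$ with $v>0$ in $\Omega$, $v=0$ on $\partial\Omega$ and $\Delta v=-\mu_1 v$ in $\Omega$, where $\Delta$ is the Laplace--Beltrami operator and $\mu_1$ is the smallest Dirichlet eigenvalue of $-\Delta$ on $\Omega$. Then there exists a constant $r_0=r_0(n)>0$, depending only on $n$, such that for every geodesic ball $B_r\subset\mathbb H^n$ of radius $0<r<r_0$ the first Dirichlet eigenfunction of $B_r$ is strictly $1$-log-concave on $B_r$. -/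

import Mathlib

noncomputable section

namespace HypBall

/-- Minkowski space `ℝ^{1,n}`, the time coordinate first. -/
abbrev Mink (n : ℕ) : Type := ℝ × EuclideanSpace ℝ (Fin n)

/-- The Lorentzian inner product `-x₀ y₀ + x₁ y₁ + ⋯ + xₙ yₙ`. -/
def mink {n : ℕ} (x y : Mink n) : ℝ := inner ℝ x.2 y.2 - x.1 * y.1

/-- Hyperbolic space `ℍⁿ` (constant sectional curvature `-1`), as the upper sheet of the
hyperboloid `⟨x, x⟩ = -1` in Minkowski space. -/
def Hyp (n : ℕ) : Type := {x : Mink n // mink x x = -1 ∧ 0 < x.1}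

instance (n : ℕ) : TopologicalSpace (Hyp n) :=
  inferInstanceAs (TopologicalSpace {x : Mink n // mink x x = -1 ∧ 0 < x.1})

/-- The hyperbolic distance, `cosh d(x, y) = -⟨x, y⟩`. -/
def hdist {n : ℕ} (x y : Hyp n) : ℝ := Real.arcosh (-mink x.1 y.1)

/-- The open geodesic ball with centre `p` and radius `r`. -/
def geodesicBall {n : ℕ} (p : Hyp n) (r : ℝ) : Set (Hyp n) := {x | hdist p x < r}

/-- The tangent space of `ℍⁿ` at `x`: the Lorentz-orthogonal complement of `x`. The Riemannian
metric is the restriction of `mink` to it. -/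
def tangentSpace {n : ℕ} (x : Hyp n) : Submodule ℝ (Mink n) where
  carrier := {X | mink x.1 X = 0}
  add_mem' := by
    intro a b ha hb
    change inner ℝ x.1.2 a.2 - x.1.1 * a.1 = 0 at ha
    change inner ℝ x.1.2 b.2 - x.1.1 * b.1 = 0 at hb
    change inner ℝ x.1.2 (a.2 + b.2) - x.1.1 * (a.1 + b.1) = 0
    rw [inner_add_right]
    linarith
  zero_mem' := by
    change mink x.1 0 = 0
    simp [mink]
  smul_mem' := by
    intro c a ha
    change inner ℝ x.1.2 a.2 - x.1.1 * a.1 = 0 at ha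
    change inner ℝ x.1.2 (c • a.2) - x.1.1 * (c * a.1) = 0
    rw [inner_smul_right]
    linear_combination c * ha

/-- The Riemannian length of a tangent vector. -/
def tlen {n : ℕ} {x : Hyp n} (X : tangentSpace x) : ℝ := Real.sqrt (mink X.1 X.1)

theorem tangent_bound {n : ℕ} {x : Hyp n} (X : tangentSpace x) :
    X.1.1 ^ 2 ≤ mink X.1 X.1 * (x.1.1 ^ 2 - 1) ∧ 1 ≤ x.1.1 ^ 2 := by
  obtain ⟨⟨a, u⟩, hx, ha⟩ := x
  obtain ⟨⟨b, w⟩, hX⟩ := X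
  change inner ℝ u w - a * b = 0 at hX
  simp only [mink, real_inner_self_eq_norm_sq] at hx ha ⊢
  have h := real_inner_mul_inner_self_le u w
  simp only [real_inner_self_eq_norm_sq] at h
  have h1 : inner ℝ u w = a * b := by linarith
  rw [h1] at h
  have h2 : ‖u‖ ^ 2 = a ^ 2 - 1 := by linarith
  rw [h2] at h
  exact ⟨by nlinarith, by nlinarith [sq_nonneg ‖u‖]⟩

theorem mink_tangent_nonneg {n : ℕ} {x : Hyp n} (X : tangentSpace x) : 0 ≤ mink X.1 X.1 := by
  obtain ⟨h, h'⟩ := tangent_bound X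
  by_contra hneg
  push Not at hneg
  have hb : X.1.1 = 0 := by nlinarith [sq_nonneg X.1.1]
  simp only [mink, hb, real_inner_self_eq_norm_sq] at hneg
  nlinarith [sq_nonneg ‖X.1.2‖]

theorem exp_mem {n : ℕ} {x : Hyp n} (X : tangentSpace x) :
    mink (Real.cosh (tlen X) • x.1 + (Real.sinh (tlen X) / tlen X) • X.1)
        (Real.cosh (tlen X) • x.1 + (Real.sinh (tlen X) / tlen X) • X.1) = -1 ∧
      0 < (Real.cosh (tlen X) • x.1 + (Real.sinh (tlen X) / tlen X) • X.1).1 := by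
  have hs : tlen X ^ 2 = mink X.1 X.1 := Real.sq_sqrt (mink_tangent_nonneg X)
  have hs0 : 0 ≤ tlen X := Real.sqrt_nonneg _
  obtain ⟨h, h'⟩ := tangent_bound X
  generalize tlen X = s at *
  obtain ⟨⟨a, u⟩, hx, ha⟩ := x
  obtain ⟨⟨b, w⟩, hX⟩ := X
  change inner ℝ u w - a * b = 0 at hX
  simp only [mink] at hx ha hs h h' ⊢
  have hcs := Real.cosh_sq s
  simp only [Prod.smul_mk, Prod.mk_add_mk, smul_eq_mul, inner_add_left, inner_add_right,
    inner_smul_left, inner_smul_right, real_inner_comm u w, conj_trivial]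
  rcases hs0.eq_or_lt with h0 | h0
  · subst h0
    rw [real_inner_self_eq_norm_sq] at hx
    simp
    exact ⟨hx, ha⟩
  · set k := Real.sinh s / s with hk
    have hks : k * s = Real.sinh s := by rw [hk]; field_simp
    have hk0 : 0 < k := div_pos (Real.sinh_pos_iff.2 h0) h0
    constructor
    · have : k ^ 2 * s ^ 2 = Real.sinh s ^ 2 := by rw [← hks]; ring
      linear_combination (Real.cosh s) ^ 2 * hx + 2 * k * Real.cosh s * hX - k ^ 2 * hs
        - hcs + this
    · have hb : |b| ≤ s * a := by
        apply abs_le_of_sq_le_sq _ (by positivity)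
        nlinarith
      have h1 : k * |b| ≤ Real.sinh s * a := by
        rw [← hks]
        nlinarith
      have h2 : -|b| ≤ b := neg_abs_le b
      have h3 := Real.sinh_lt_cosh s
      nlinarith

/-- The exponential map `exp_x X = cosh |X| x + (sinh |X| / |X|) X`. For fixed `X`, the curve
`t ↦ exp_x (t X)` is the geodesic with initial point `x` and initial velocity `X`. -/
def hexp {n : ℕ} (x : Hyp n) (X : tangentSpace x) : Hyp n :=
  ⟨Real.cosh (tlen X) • x.1 + (Real.sinh (tlen X) / tlen X) • X.1, exp_mem X⟩

/-- The derivative of `f` at `x` in the direction of the tangent vector `X`. -/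
def dirDeriv {n : ℕ} (f : Hyp n → ℝ) (x : Hyp n) (X : tangentSpace x) : ℝ :=
  deriv (fun t : ℝ => f (hexp x (t • X))) 0

/-- The quadratic form `∇²f (X, X)` of the Riemannian Hessian: the second derivative of `f` along
the geodesic with initial velocity `X`. -/
def hessQuad {n : ℕ} (f : Hyp n → ℝ) (x : Hyp n) (X : tangentSpace x) : ℝ :=
  iteratedDeriv 2 (fun t : ℝ => f (hexp x (t • X))) 0

/-- The Riemannian Hessian `∇²f (X, Y)`, by polarization of its quadratic form. -/
def hess {n : ℕ} (f : Hyp n → ℝ) (x : Hyp n) (X Y : tangentSpace x) : ℝ :=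
  (hessQuad f x (X + Y) - hessQuad f x (X - Y)) / 4

theorem frame_mem {n : ℕ} (x : Hyp n) (i : Fin n) :
    ((x.1.2 i, EuclideanSpace.single i 1 + (x.1.2 i / (1 + x.1.1)) • x.1.2) : Mink n) ∈
      tangentSpace x := by
  obtain ⟨⟨a, u⟩, hx, ha⟩ := x
  simp only [mink] at hx ha
  change inner ℝ u (EuclideanSpace.single i 1 + (u i / (1 + a)) • u) - a * u i = 0
  have h : inner ℝ u u = a ^ 2 - 1 := by linarith
  have h1 : (1 + a) ≠ 0 := by positivity
  rw [inner_add_right, inner_smul_right, h, EuclideanSpace.inner_single_right]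
  simp
  field_simp
  ring

/-- An orthonormal frame of `ℍⁿ`: the images of the standard basis vectors of `ℝⁿ` under the
Lorentz boost that takes `(1, 0)` to `x`. -/
def frame {n : ℕ} (x : Hyp n) (i : Fin n) : tangentSpace x :=
  ⟨(x.1.2 i, EuclideanSpace.single i 1 + (x.1.2 i / (1 + x.1.1)) • x.1.2), frame_mem x i⟩

theorem frame_orthonormal {n : ℕ} (x : Hyp n) (i j : Fin n) :
    mink (frame x i).1 (frame x j).1 = if i = j then 1 else 0 := by
  obtain ⟨⟨a, u⟩, hx, ha⟩ := x
  simp only [mink] at hx ha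
  change inner ℝ (EuclideanSpace.single i 1 + (u i / (1 + a)) • u)
    (EuclideanSpace.single j 1 + (u j / (1 + a)) • u) - u i * u j = _
  have h : inner ℝ u u = a ^ 2 - 1 := by linarith
  have h1 : (1 + a) ≠ 0 := by positivity
  have h2 : inner ℝ (EuclideanSpace.single i (1 : ℝ)) (EuclideanSpace.single j (1 : ℝ)) =
      if i = j then (1 : ℝ) else 0 := by
    simp [EuclideanSpace.inner_single_left]
  simp only [inner_add_left, inner_add_right, inner_smul_left, inner_smul_right, h, h2,
    EuclideanSpace.inner_single_left, EuclideanSpace.inner_single_right, conj_trivial]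
  field_simp
  ring

/-- The norm `|∇f|` of the Riemannian gradient at `x`. -/
def gradNorm {n : ℕ} (f : Hyp n → ℝ) (x : Hyp n) : ℝ :=
  Real.sqrt (∑ i, dirDeriv f x (frame x i) ^ 2)

/-- The matrix `f_{ij}` of the Riemannian Hessian at `x` in the orthonormal frame. -/
def hessMatrix {n : ℕ} (f : Hyp n → ℝ) (x : Hyp n) : Matrix (Fin n) (Fin n) ℝ :=
  Matrix.of fun i j => hess f x (frame x i) (frame x j)

/-- The Laplace–Beltrami operator, the trace of the Hessian. -/
def laplaceBeltrami {n : ℕ} (f : Hyp n → ℝ) (x : Hyp n) : ℝ := (hessMatrix f x).trace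

theorem chart_mem {n : ℕ} (y : EuclideanSpace ℝ (Fin n)) :
    mink ((Real.sqrt (1 + ‖y‖ ^ 2), y) : Mink n) (Real.sqrt (1 + ‖y‖ ^ 2), y) = -1 ∧
      0 < ((Real.sqrt (1 + ‖y‖ ^ 2), y) : Mink n).1 := by
  refine ⟨?_, Real.sqrt_pos.2 (by positivity)⟩
  simp only [mink, real_inner_self_eq_norm_sq]
  rw [Real.mul_self_sqrt (by positivity)]
  ring

/-- The global smooth parametrization of the hyperboloid as a graph over `ℝⁿ`. -/
def chart {n : ℕ} (y : EuclideanSpace ℝ (Fin n)) : Hyp n :=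
  ⟨(Real.sqrt (1 + ‖y‖ ^ 2), y), chart_mem y⟩

/-- `f` is of class `C²` on the (open) set `Ω`. -/
def IsC2On {n : ℕ} (f : Hyp n → ℝ) (Ω : Set (Hyp n)) : Prop :=
  ContDiffOn ℝ 2 (fun y => f (chart y)) (chart ⁻¹' Ω)

/-- `u` is a (classical) Dirichlet eigenfunction of the Laplacian on `Ω` with eigenvalue `μ`:
`Δu = -μ u` in `Ω`, `u = 0` on `∂Ω`, `u ≢ 0`. -/
structure IsDirichletEigenfunction {n : ℕ} (Ω : Set (Hyp n)) (μ : ℝ) (u : Hyp n → ℝ) : Prop where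
  c2 : IsC2On u Ω
  cont : ContinuousOn u (closure Ω)
  eqn : ∀ x ∈ Ω, laplaceBeltrami u x = -μ * u x
  bdry : ∀ x ∈ frontier Ω, u x = 0
  nontrivial : ∃ x ∈ Ω, u x ≠ 0

/-- `μ` is the first (that is, the smallest) Dirichlet eigenvalue of the Laplacian on `Ω`. -/
def IsFirstEigenvalue {n : ℕ} (Ω : Set (Hyp n)) (μ : ℝ) : Prop :=
  IsLeast {ν : ℝ | ∃ u : Hyp n → ℝ, IsDirichletEigenfunction Ω ν u} μ

/-- `v` is a first Dirichlet eigenfunction of the Laplacian on `Ω`, with the sign `v > 0`. -/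
def IsFirstEigenfunction {n : ℕ} (Ω : Set (Hyp n)) (v : Hyp n → ℝ) : Prop :=
  ∃ μ : ℝ, IsFirstEigenvalue Ω μ ∧ IsDirichletEigenfunction Ω μ v ∧ ∀ x ∈ Ω, 0 < v x

/-- A positive function `f` is strictly `lam`-log-concave on `Ω`: the matrix
`-(log f)_{ij} - lam |∇ log f| δ_{ij}` is positive definite at every point of `Ω`. -/
def StrictlyLogConcaveOn {n : ℕ} (lam : ℝ) (f : Hyp n → ℝ) (Ω : Set (Hyp n)) : Prop :=
  ∀ x ∈ Ω, 0 < f x ∧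
    Matrix.PosDef (-hessMatrix (fun y => Real.log (f y)) x -
      (lam * gradNorm (fun y => Real.log (f y)) x) • (1 : Matrix (Fin n) (Fin n) ℝ))

end HypBall

end

/-!
Comparing a positive eigenfunction `v` with its reflections in the hyperplanes through the centre,
by the maximum principle, shows that `v` is radial; write `log v = ℓ ∘ d(p, ·)`. The eigenvalue
equation becomes a Riccati equation for `ℓ'`, and integrating factors turn it into the inequalities
`ℓ'' < ℓ' < 0`, the first one for balls so small that `sinh⁻² - coth > 1`. The eigenvalues of the
Hessian of `log v` are `ℓ''` and `ℓ' coth`, and both are smaller than `-|∇ log v| = ℓ'`.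
-/

open Set Filter Topology

namespace HypBall

variable {n : ℕ}

theorem mink_comm (x y : Mink n) : mink x y = mink y x := by
  simp only [mink, real_inner_comm x.2 y.2, mul_comm]

theorem mink_add_right (x y z : Mink n) : mink x (y + z) = mink x y + mink x z := by
  simp only [mink, Prod.fst_add, Prod.snd_add, inner_add_right]; ring

theorem mink_smul_right (c : ℝ) (x y : Mink n) : mink x (c • y) = c * mink x y := by
  simp only [mink, Prod.smul_fst, Prod.smul_snd, real_inner_smul_right, smul_eq_mul]; ring

theorem mink_sub_right (x y z : Mink n) : mink x (y - z) = mink x y - mink x z := by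
  simp only [mink, Prod.fst_sub, Prod.snd_sub, inner_sub_right]; ring

theorem mink_add_left (x y z : Mink n) : mink (x + y) z = mink x z + mink y z := by
  rw [mink_comm, mink_add_right, mink_comm z, mink_comm z]

theorem mink_smul_left (c : ℝ) (x y : Mink n) : mink (c • x) y = c * mink x y := by
  rw [mink_comm, mink_smul_right, mink_comm]

theorem mink_sub_left (x y z : Mink n) : mink (x - y) z = mink x z - mink y z := by
  rw [mink_comm, mink_sub_right, mink_comm z, mink_comm z]

theorem mink_sum_right {ι : Type*} (s : Finset ι) (x : Mink n) (y : ι → Mink n) :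
    mink x (∑ i ∈ s, y i) = ∑ i ∈ s, mink x (y i) :=
  map_sum (AddMonoidHom.mk' (mink x) (mink_add_right x)) y s

theorem mink_zero_right (x : Mink n) : mink x 0 = 0 := by simp [mink]

theorem mink_tangent {x : Hyp n} (X : tangentSpace x) : mink x.1 X.1 = 0 := X.2

theorem norm_sq_snd (x : Hyp n) : ‖x.1.2‖ ^ 2 = x.1.1 ^ 2 - 1 := by
  have h := x.2.1
  rw [mink, real_inner_self_eq_norm_sq] at h
  linarith

theorem norm_snd_lt_fst (x : Hyp n) : ‖x.1.2‖ < x.1.1 :=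
  lt_of_pow_lt_pow_left₀ 2 x.2.2.le (by linarith [norm_sq_snd x])

theorem tlen_sq {x : Hyp n} (X : tangentSpace x) : tlen X ^ 2 = mink X.1 X.1 :=
  Real.sq_sqrt (mink_tangent_nonneg X)

theorem tlen_smul {x : Hyp n} (t : ℝ) (X : tangentSpace x) : tlen (t • X) = |t| * tlen X := by
  rw [tlen, tlen, Submodule.coe_smul, mink_smul_left, mink_smul_right, ← mul_assoc,
    Real.sqrt_mul (mul_self_nonneg t), Real.sqrt_mul_self_eq_abs]

theorem eq_zero_of_tlen_eq_zero {x : Hyp n} {X : tangentSpace x} (h : tlen X = 0) : X = 0 := by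
  have hX : mink X.1 X.1 = 0 := by rw [← tlen_sq, h, sq, zero_mul]
  have hfst : X.1.1 = 0 := by nlinarith [(tangent_bound X).1]
  have hsnd : X.1.2 = 0 := by
    rw [mink, hfst, mul_zero, sub_zero] at hX
    exact inner_self_eq_zero.1 hX
  exact Subtype.ext (Prod.ext hfst hsnd)

/-- The hyperbolic cosine of the distance. -/
noncomputable def coshDist (p x : Hyp n) : ℝ := -mink p.1 x.1

theorem coshDist_self (p : Hyp n) : coshDist p p = 1 := by
  rw [coshDist, p.2.1, neg_neg]

theorem coshDist_ge (p x : Hyp n) : (p.1.1 - ‖p.1.2‖) * ‖x.1.2‖ ≤ coshDist p x := by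
  have hinner := real_inner_le_norm p.1.2 x.1.2
  have hfst := mul_le_mul_of_nonneg_left (norm_snd_lt_fst x).le p.2.2.le
  rw [coshDist, mink]
  linarith

theorem radialVector_mem (p x : Hyp n) : p.1 - coshDist p x • x.1 ∈ tangentSpace x := by
  change mink x.1 (p.1 - coshDist p x • x.1) = 0
  rw [mink_sub_right, mink_smul_right, x.2.1, mink_comm, coshDist]
  ring

/-- The tangential part of `p` at `x`: the vector pointing from `x` to `p` of length `sinh d(p, x)`,
that is, minus the gradient of `coshDist p`. -/
noncomputable def radialVector (p x : Hyp n) : tangentSpace x :=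
  ⟨p.1 - coshDist p x • x.1, radialVector_mem p x⟩

theorem mink_radialVector (p : Hyp n) {x : Hyp n} (X : tangentSpace x) :
    mink (radialVector p x).1 X.1 = mink p.1 X.1 := by
  rw [radialVector, mink_sub_left, mink_smul_left, mink_tangent, mul_zero, sub_zero]

theorem mink_center_radialVector (p x : Hyp n) :
    mink p.1 (radialVector p x).1 = coshDist p x ^ 2 - 1 := by
  rw [radialVector, mink_sub_right, mink_smul_right, p.2.1, coshDist]
  ring

theorem mink_radialVector_self (p x : Hyp n) :
    mink (radialVector p x).1 (radialVector p x).1 = coshDist p x ^ 2 - 1 := by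
  rw [mink_radialVector, mink_center_radialVector]

theorem one_le_coshDist (p x : Hyp n) : 1 ≤ coshDist p x := by
  have hnonneg : 0 ≤ coshDist p x :=
    (mul_nonneg (sub_nonneg.2 (norm_snd_lt_fst p).le) (norm_nonneg _)).trans (coshDist_ge p x)
  have hsq := mink_tangent_nonneg (radialVector p x)
  rw [mink_radialVector_self, sub_nonneg] at hsq
  exact (one_le_sq_iff₀ hnonneg).1 hsq

theorem one_lt_coshDist {p x : Hyp n} (h : x ≠ p) : 1 < coshDist p x := by
  refine (one_le_coshDist p x).lt_of_ne' fun hs => h ?_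
  have hR : radialVector p x = 0 := eq_zero_of_tlen_eq_zero <| by
    rw [tlen, mink_radialVector_self, hs, one_pow, sub_self, Real.sqrt_zero]
  have hpx : p.1 - coshDist p x • x.1 = 0 := congrArg Subtype.val hR
  rw [hs, one_smul, sub_eq_zero] at hpx
  exact Subtype.ext hpx.symm

theorem hdist_nonneg (p x : Hyp n) : 0 ≤ hdist p x := Real.arcosh_nonneg (one_le_coshDist p x)

theorem hdist_pos {p x : Hyp n} (h : x ≠ p) : 0 < hdist p x := Real.arcosh_pos (one_lt_coshDist h)

theorem cosh_hdist (p x : Hyp n) : Real.cosh (hdist p x) = coshDist p x :=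
  Real.cosh_arcosh (one_le_coshDist p x)

theorem geodesicBall_eq (p : Hyp n) {r : ℝ} (hr : 0 < r) :
    geodesicBall p r = {x | coshDist p x < Real.cosh r} := by
  ext x
  rw [mem_ofPred_eq, ← cosh_hdist, Real.cosh_lt_cosh, abs_of_nonneg (hdist_nonneg p x),
    abs_of_pos hr]
  rfl

/-! ### The orthonormal frame -/

theorem eq_zero_of_mink_frame_eq_zero {x : Hyp n} {X : tangentSpace x}
    (h : ∀ i, mink X.1 (frame x i).1 = 0) : X = 0 := by
  have hx : 0 < x.1.1 := x.2.2
  have hinner : inner ℝ x.1.2 X.1.2 = x.1.1 * X.1.1 := sub_eq_zero.1 (mink_tangent X)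
  have hsnd : X.1.2 = (X.1.1 / (1 + x.1.1)) • x.1.2 := by
    ext i
    have hi : inner ℝ X.1.2 (EuclideanSpace.single i 1 + (x.1.2 i / (1 + x.1.1)) • x.1.2) -
        X.1.1 * x.1.2 i = 0 := h i
    rw [inner_add_right, real_inner_smul_right, EuclideanSpace.inner_single_right,
      real_inner_comm, hinner] at hi
    simp only [one_mul, conj_trivial] at hi
    rw [PiLp.smul_apply, smul_eq_mul]
    field_simp at hi ⊢
    linear_combination hi
  have hfst : X.1.1 = 0 := by
    rw [hsnd, real_inner_smul_right, real_inner_self_eq_norm_sq, norm_sq_snd] at hinner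
    field_simp at hinner
    have hmul : X.1.1 * (1 + x.1.1) = 0 := by linear_combination -hinner
    exact (mul_eq_zero.1 hmul).resolve_right (by positivity)
  rw [hfst, zero_div, zero_smul] at hsnd
  exact Subtype.ext (Prod.ext hfst hsnd)

theorem sum_mink_frame_smul {x : Hyp n} (X : tangentSpace x) :
    ∑ i, mink X.1 (frame x i).1 • frame x i = X := by
  refine (sub_eq_zero.1 (eq_zero_of_mink_frame_eq_zero fun j => ?_)).symm
  rw [Submodule.coe_sub, mink_sub_left, mink_comm (Subtype.val (Finset.sum _ _)),
    Submodule.coe_sum, mink_sum_right]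
  simp [mink_smul_right, frame_orthonormal]

theorem sum_mink_frame_mul {x : Hyp n} (X Y : tangentSpace x) :
    ∑ i, mink X.1 (frame x i).1 * mink Y.1 (frame x i).1 = mink X.1 Y.1 := by
  conv_rhs => rw [← sum_mink_frame_smul Y, Submodule.coe_sum, mink_sum_right]
  simp only [Submodule.coe_smul, mink_smul_right, mul_comm]

theorem sum_mink_center_frame_sq (p x : Hyp n) :
    ∑ i, mink p.1 (frame x i).1 ^ 2 = coshDist p x ^ 2 - 1 := by
  rw [← mink_radialVector_self, ← sum_mink_frame_mul]
  simp only [mink_radialVector, sq]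

theorem bilin_sum_eq_of_orthonormal {x : Hyp n} (B : LinearMap.BilinForm ℝ (tangentSpace x))
    {E : Fin n → tangentSpace x} (hE : ∀ i j, mink (E i).1 (E j).1 = if i = j then 1 else 0) :
    ∑ i, B (E i) (E i) = ∑ i, B (frame x i) (frame x i) := by
  let O : Matrix (Fin n) (Fin n) ℝ := .of fun i j => mink (E i).1 (frame x j).1
  let M : Matrix (Fin n) (Fin n) ℝ := .of fun i j => B (frame x i) (frame x j)
  have hO : O * O.transpose = 1 := by
    ext i j
    rw [Matrix.mul_apply, Matrix.one_apply, ← hE i j, ← sum_mink_frame_mul]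
    rfl
  have hB : ∀ i, B (E i) (E i) = (O * M * O.transpose) i i := fun i => by
    conv_lhs => rw [← sum_mink_frame_smul (E i)]
    simp only [map_sum, map_smul, LinearMap.sum_apply, LinearMap.smul_apply, smul_eq_mul,
      Matrix.mul_apply, Finset.mul_sum, Finset.sum_mul]
    exact Finset.sum_congr rfl fun j _ => Finset.sum_congr rfl fun k _ => by
      simp only [O, M, Matrix.of_apply, Matrix.transpose_apply]; ring
  calc ∑ i, B (E i) (E i) = (O * M * O.transpose).trace := Finset.sum_congr rfl fun i _ => hB i
    _ = M.trace := by
      rw [Matrix.trace_mul_comm, ← Matrix.mul_assoc, mul_eq_one_comm.1 hO, Matrix.one_mul]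

/-! ### Geodesics -/

theorem hexp_smul {x : Hyp n} (t : ℝ) (X : tangentSpace x) :
    (hexp x (t • X)).1 =
      Real.cosh (t * tlen X) • x.1 + (Real.sinh (t * tlen X) / tlen X) • X.1 := by
  change Real.cosh (tlen (t • X)) • x.1 + (Real.sinh (tlen (t • X)) / tlen (t • X)) • (t • X.1) = _
  rw [tlen_smul, smul_smul]
  rcases abs_choice t with ht | ht <;> rw [ht]
  · rcases eq_or_ne t 0 with rfl | ht0
    · simp
    · rw [div_mul_eq_mul_div, mul_comm _ t, mul_div_mul_left _ _ ht0]
  · rcases eq_or_ne t 0 with rfl | ht0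
    · simp
    · rw [neg_mul, Real.cosh_neg, Real.sinh_neg, neg_div_neg_eq, div_mul_eq_mul_div, mul_comm _ t,
        mul_div_mul_left _ _ ht0]

theorem hexp_zero_smul {x : Hyp n} (X : tangentSpace x) : hexp x ((0 : ℝ) • X) = x := by
  apply Subtype.ext
  rw [hexp_smul]
  simp

theorem continuous_hexp {x : Hyp n} (X : tangentSpace x) :
    Continuous fun t : ℝ => hexp x (t • X) := by
  refine Continuous.subtype_mk (f := fun t : ℝ => (hexp x (t • X)).1) ?_ _
  simp only [hexp_smul]
  fun_prop

theorem tendsto_hexp {x : Hyp n} (X : tangentSpace x) :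
    Tendsto (fun t : ℝ => hexp x (t • X)) (𝓝 0) (𝓝 x) := by
  simpa only [hexp_zero_smul] using (continuous_hexp X).tendsto 0

theorem coshDist_hexp (p : Hyp n) {x : Hyp n} (t : ℝ) (X : tangentSpace x) :
    coshDist p (hexp x (t • X)) = Real.cosh (t * tlen X) • coshDist p x +
      (Real.sinh (t * tlen X) / tlen X) • (-mink p.1 X.1) := by
  rw [coshDist, hexp_smul, mink_add_right, mink_smul_right, mink_smul_right, coshDist, smul_eq_mul,
    smul_eq_mul]
  ring

theorem coshDist_hexp_self {p : Hyp n} (t : ℝ) (X : tangentSpace p) :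
    coshDist p (hexp p (t • X)) = Real.cosh (t * tlen X) := by
  rw [coshDist_hexp, mink_tangent, coshDist_self]
  simp

section CoshSinhCurve

variable {E : Type*} [NormedAddCommGroup E] [NormedSpace ℝ E] {l : ℝ} {a b : E}

/-- The curve solves `c'' = l² c` with `c 0 = a` and `c' 0 = b`; as `sinh (t l) / l` is zero for
`l = 0`, the latter needs `b = 0` in that case. -/
theorem hasDerivAt_cosh_smul_add_sinh_smul (h : l = 0 → b = 0) (t : ℝ) :
    HasDerivAt (fun t => Real.cosh (t * l) • a + (Real.sinh (t * l) / l) • b)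
      (Real.cosh (t * l) • b + (Real.sinh (t * l) / l) • (l ^ 2 • a)) t := by
  have hl : HasDerivAt (fun t => t * l) l t := by simpa using (hasDerivAt_id t).mul_const l
  refine ((hl.cosh.smul_const a).add ((hl.sinh.div_const l).smul_const b)).congr_deriv ?_
  rcases eq_or_ne l 0 with rfl | hl0
  · simp [h rfl]
  · rw [smul_smul, mul_div_cancel_right₀ _ hl0, add_comm]
    congr 2
    field_simp

theorem deriv_cosh_smul_add_sinh_smul (h : l = 0 → b = 0) :
    deriv (fun t => Real.cosh (t * l) • a + (Real.sinh (t * l) / l) • b) 0 = b := by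
  rw [(hasDerivAt_cosh_smul_add_sinh_smul h 0).deriv]
  simp

theorem iteratedDeriv_two_cosh_smul_add_sinh_smul (h : l = 0 → b = 0) :
    iteratedDeriv 2 (fun t => Real.cosh (t * l) • a + (Real.sinh (t * l) / l) • b) 0 =
      l ^ 2 • a := by
  rw [iteratedDeriv_succ, iteratedDeriv_one,
    funext fun t => (hasDerivAt_cosh_smul_add_sinh_smul (a := a) h t).deriv]
  exact deriv_cosh_smul_add_sinh_smul fun hl => by rw [hl]; simp

end CoshSinhCurve

/-! ### Topology of geodesic balls -/

theorem chart_snd (x : Hyp n) : chart x.1.2 = x := by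
  refine Subtype.ext (Prod.ext ?_ rfl)
  change Real.sqrt (1 + ‖x.1.2‖ ^ 2) = x.1.1
  rw [norm_sq_snd, add_sub_cancel, Real.sqrt_sq x.2.2.le]

theorem continuous_chart : Continuous (chart : EuclideanSpace ℝ (Fin n) → Hyp n) := by
  refine Continuous.subtype_mk (f := fun y => ((Real.sqrt (1 + ‖y‖ ^ 2), y) : Mink n)) ?_ _
  fun_prop

theorem continuous_val : Continuous fun x : Hyp n => x.1 := continuous_subtype_val

theorem continuous_coshDist (p : Hyp n) : Continuous (coshDist p) := by
  have := continuous_val (n := n)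
  unfold coshDist mink
  fun_prop

theorem isCompact_coshDist_le (p : Hyp n) (S : ℝ) : IsCompact {x | coshDist p x ≤ S} := by
  have hp : 0 < p.1.1 - ‖p.1.2‖ := sub_pos.2 (norm_snd_lt_fst p)
  refine ((isCompact_closedBall (0 : EuclideanSpace ℝ (Fin n)) (S / (p.1.1 - ‖p.1.2‖))).image
    continuous_chart).of_isClosed_subset (isClosed_le (continuous_coshDist p) continuous_const)
    fun x hx => ⟨x.1.2, ?_, chart_snd x⟩
  rw [mem_closedBall_zero_iff, le_div_iff₀ hp, mul_comm]
  exact (coshDist_ge p x).trans hx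

theorem isOpen_coshDist_lt (p : Hyp n) (S : ℝ) : IsOpen {x | coshDist p x < S} :=
  isOpen_lt (continuous_coshDist p) continuous_const

/-! ### Functions of class `C²` and their Hessians -/

/-- `f` is of class `C²` in a neighbourhood of `x`. -/
def IsC2At (f : Hyp n → ℝ) (x : Hyp n) : Prop :=
  ContDiffAt ℝ 2 (fun y => f (chart y)) x.1.2

theorem IsC2On.isC2At {f : Hyp n → ℝ} {Ω : Set (Hyp n)} (h : IsC2On f Ω) (hΩ : IsOpen Ω)
    {x : Hyp n} (hx : x ∈ Ω) : IsC2At f x := by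
  refine h.contDiffAt ((hΩ.preimage continuous_chart).mem_nhds ?_)
  rwa [mem_preimage, chart_snd]

theorem IsC2At.sub_const_mul {f g : Hyp n → ℝ} {x : Hyp n} (hf : IsC2At f x) (hg : IsC2At g x)
    (c : ℝ) : IsC2At (fun y => f y - c * g y) x :=
  ContDiffAt.sub hf (contDiffAt_const.mul hg)

theorem IsC2At.comp {k : ℝ → ℝ} {f : Hyp n → ℝ} {x : Hyp n} (hk : ContDiffAt ℝ 2 k (f x))
    (hf : IsC2At f x) : IsC2At (fun y => k (f y)) x :=
  ContDiffAt.comp (g := k) x.1.2 (by rwa [chart_snd]) hf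

theorem comp_hexp_eq (f : Hyp n → ℝ) {x : Hyp n} (X : tangentSpace x) :
    (fun t : ℝ => f (hexp x (t • X))) = (fun y => f (chart y)) ∘ fun t =>
      Real.cosh (t * tlen X) • x.1.2 + (Real.sinh (t * tlen X) / tlen X) • X.1.2 := by
  ext t
  rw [← chart_snd (hexp x (t • X)), hexp_smul]
  rfl

theorem IsC2At.contDiffAt_comp_hexp {f : Hyp n → ℝ} {x : Hyp n} {X : tangentSpace x} {t : ℝ}
    (hf : IsC2At f (hexp x (t • X))) : ContDiffAt ℝ 2 (fun t : ℝ => f (hexp x (t • X))) t := by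
  rw [comp_hexp_eq]
  rw [IsC2At, hexp_smul] at hf
  exact ContDiffAt.comp t hf (by fun_prop)

theorem IsC2At.contDiffAt_comp_hexp_zero {f : Hyp n → ℝ} {x : Hyp n} (hf : IsC2At f x)
    (X : tangentSpace x) : ContDiffAt ℝ 2 (fun t : ℝ => f (hexp x (t • X))) 0 :=
  contDiffAt_comp_hexp (by rwa [hexp_zero_smul])

theorem IsC2At.hasDerivAt_comp_hexp {f : Hyp n → ℝ} {x : Hyp n} (hf : IsC2At f x)
    (X : tangentSpace x) : HasDerivAt (fun t : ℝ => f (hexp x (t • X))) (dirDeriv f x X) 0 :=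
  ((hf.contDiffAt_comp_hexp_zero X).differentiableAt two_ne_zero).hasDerivAt

theorem dirDeriv_congr {f g : Hyp n → ℝ} {x : Hyp n} (h : f =ᶠ[𝓝 x] g) (X : tangentSpace x) :
    dirDeriv f x X = dirDeriv g x X :=
  (h.comp_tendsto (tendsto_hexp X)).deriv_eq

theorem hessQuad_congr {f g : Hyp n → ℝ} {x : Hyp n} (h : f =ᶠ[𝓝 x] g) (X : tangentSpace x) :
    hessQuad f x X = hessQuad g x X :=
  (h.comp_tendsto (tendsto_hexp X)).iteratedDeriv_eq 2

theorem iteratedDeriv_two_comp_mul_left (c : ℝ) (f : ℝ → ℝ) (t : ℝ) :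
    iteratedDeriv 2 (fun t => f (c * t)) t = c ^ 2 * iteratedDeriv 2 f (c * t) := by
  have hderiv : deriv (fun t => f (c * t)) = fun t => c • deriv f (c * t) :=
    funext fun t => deriv_comp_mul_left c f t
  rw [iteratedDeriv_succ, iteratedDeriv_one, hderiv, deriv_fun_const_smul_field,
    deriv_comp_mul_left c (deriv f), smul_smul, ← sq, smul_eq_mul, iteratedDeriv_succ,
    iteratedDeriv_one]

theorem hessQuad_smul (f : Hyp n → ℝ) {x : Hyp n} (c : ℝ) (X : tangentSpace x) :
    hessQuad f x (c • X) = c ^ 2 * hessQuad f x X := by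
  have hcomp : (fun t : ℝ => f (hexp x (t • c • X))) = fun t => f (hexp x ((c * t) • X)) := by
    simp only [smul_smul, mul_comm]
  rw [hessQuad, hcomp, iteratedDeriv_two_comp_mul_left c fun t => f (hexp x (t • X)), mul_zero,
    hessQuad]

theorem hess_self (f : Hyp n → ℝ) {x : Hyp n} (X : tangentSpace x) :
    hess f x X X = hessQuad f x X := by
  rw [hess, ← two_smul ℝ X, sub_self, ← zero_smul ℝ X, hessQuad_smul, hessQuad_smul]
  ring

theorem laplaceBeltrami_eq_sum (f : Hyp n → ℝ) (x : Hyp n) :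
    laplaceBeltrami f x = ∑ i, hessQuad f x (frame x i) := by
  simp only [laplaceBeltrami, Matrix.trace, Matrix.diag_apply, hessMatrix, Matrix.of_apply,
    hess_self]

theorem IsC2At.hessQuad_eq {f : Hyp n → ℝ} {x : Hyp n} (hf : IsC2At f x) (X : tangentSpace x) :
    hessQuad f x X = fderiv ℝ (fderiv ℝ fun y => f (chart y)) x.1.2 X.1.2 X.1.2 +
      mink X.1 X.1 * fderiv ℝ (fun y => f (chart y)) x.1.2 x.1.2 := by
  let c : ℝ → EuclideanSpace ℝ (Fin n) := fun t =>
    Real.cosh (t * tlen X) • x.1.2 + (Real.sinh (t * tlen X) / tlen X) • X.1.2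
  have hX : tlen X = 0 → X.1.2 = 0 := fun h => by
    rw [eq_zero_of_tlen_eq_zero h, Submodule.coe_zero, Prod.snd_zero]
  have hc : ContDiffAt ℝ 2 c 0 := by fun_prop
  have hc0 : c 0 = x.1.2 := by simp [c]
  have hf' : ContDiffAt ℝ 2 (fun y => f (chart y)) (c 0) := hc0 ▸ hf
  have hderiv : deriv c 0 = X.1.2 := deriv_cosh_smul_add_sinh_smul hX
  have hderiv2 : iteratedDeriv 2 c 0 = tlen X ^ 2 • x.1.2 :=
    iteratedDeriv_two_cosh_smul_add_sinh_smul hX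
  rw [hessQuad, comp_hexp_eq, iteratedDeriv_vcomp_two (f := c) hf' hc, hc0, hderiv, hderiv2,
    iteratedFDeriv_two_apply, map_smul, tlen_sq, smul_eq_mul]

theorem IsC2At.exists_bilin {f : Hyp n → ℝ} {x : Hyp n} (hf : IsC2At f x) :
    ∃ B : LinearMap.BilinForm ℝ (tangentSpace x), ∀ X, hessQuad f x X = B X X := by
  refine ⟨LinearMap.mk₂ ℝ (fun X Y =>
    fderiv ℝ (fderiv ℝ fun y => f (chart y)) x.1.2 X.1.2 Y.1.2 +
      mink X.1 Y.1 * fderiv ℝ (fun y => f (chart y)) x.1.2 x.1.2) ?_ ?_ ?_ ?_, hf.hessQuad_eq⟩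
  · intro X Y Z
    rw [Submodule.coe_add, Prod.snd_add, map_add, add_apply, mink_add_left]
    ring
  · intro c X Y
    rw [Submodule.coe_smul, Prod.smul_snd, map_smul, smul_apply, mink_smul_left, smul_eq_mul,
      smul_eq_mul]
    ring
  · intro X Y Z
    rw [Submodule.coe_add, Prod.snd_add, map_add, mink_add_right]
    ring
  · intro c X Y
    rw [Submodule.coe_smul, Prod.smul_snd, map_smul, mink_smul_right, smul_eq_mul, smul_eq_mul]
    ring

theorem laplaceBeltrami_eq_sum_of_orthonormal {f : Hyp n → ℝ} {x : Hyp n} (hf : IsC2At f x)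
    {E : Fin n → tangentSpace x} (hE : ∀ i j, mink (E i).1 (E j).1 = if i = j then 1 else 0) :
    laplaceBeltrami f x = ∑ i, hessQuad f x (E i) := by
  obtain ⟨B, hB⟩ := hf.exists_bilin
  simp only [laplaceBeltrami_eq_sum, hB, bilin_sum_eq_of_orthonormal B hE]

theorem laplaceBeltrami_sub_const_mul {f g : Hyp n → ℝ} {x : Hyp n} (hf : IsC2At f x)
    (hg : IsC2At g x) (c : ℝ) :
    laplaceBeltrami (fun y => f y - c * g y) x = laplaceBeltrami f x - c * laplaceBeltrami g x := by
  have hsub : ∀ X : tangentSpace x,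
      hessQuad (fun y => f y - c * g y) x X = hessQuad f x X - c * hessQuad g x X := fun X => by
    rw [hessQuad, iteratedDeriv_fun_sub (hf.contDiffAt_comp_hexp_zero X)
      (contDiffAt_const.mul (hg.contDiffAt_comp_hexp_zero X)), iteratedDeriv_const_mul_field]
    rfl
  simp only [laplaceBeltrami_eq_sum, hsub, Finset.sum_sub_distrib, Finset.mul_sum]

theorem dirDeriv_comp {k : ℝ → ℝ} {f : Hyp n → ℝ} {x : Hyp n} (hk : DifferentiableAt ℝ k (f x))
    (hf : IsC2At f x) (X : tangentSpace x) :
    dirDeriv (fun y => k (f y)) x X = deriv k (f x) * dirDeriv f x X := by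
  rw [← hexp_zero_smul X] at hk
  have h := (hk.hasDerivAt.comp (0 : ℝ) (hf.hasDerivAt_comp_hexp X)).deriv
  rwa [hexp_zero_smul] at h

theorem hessQuad_comp {k : ℝ → ℝ} {f : Hyp n → ℝ} {x : Hyp n} (hk : ContDiffAt ℝ 2 k (f x))
    (hf : IsC2At f x) (X : tangentSpace x) :
    hessQuad (fun y => k (f y)) x X =
      iteratedDeriv 2 k (f x) * dirDeriv f x X ^ 2 + deriv k (f x) * hessQuad f x X := by
  rw [← hexp_zero_smul X] at hk
  have h := iteratedDeriv_comp_two hk (hf.contDiffAt_comp_hexp_zero X)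
  rwa [hexp_zero_smul] at h

theorem iteratedDeriv_two_nonneg_of_isLocalMin {f : ℝ → ℝ} {t : ℝ} (h : IsLocalMin f t)
    (hc : ContinuousAt f t) : 0 ≤ iteratedDeriv 2 f t := by
  rw [iteratedDeriv_succ, iteratedDeriv_one]
  by_contra! hneg
  have hmax := isLocalMax_of_deriv_deriv_neg hneg h.deriv_eq_zero hc
  have hconst : f =ᶠ[𝓝 t] fun _ => f t := by
    filter_upwards [h, hmax] with y hle hge using le_antisymm hge hle
  rw [hconst.deriv.deriv_eq] at hneg
  simp at hneg

theorem laplaceBeltrami_nonneg_of_isLocalMin {f : Hyp n → ℝ} {x : Hyp n} (hf : IsC2At f x)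
    (h : IsLocalMin f x) : 0 ≤ laplaceBeltrami f x := by
  rw [laplaceBeltrami_eq_sum]
  refine Finset.sum_nonneg fun i _ => iteratedDeriv_two_nonneg_of_isLocalMin ?_
    (hf.contDiffAt_comp_hexp_zero _).continuousAt
  rw [IsLocalMin, IsMinFilter, hexp_zero_smul]
  exact (tendsto_hexp _).eventually h

/-! ### Radial functions -/

theorem isC2At_coshDist (p x : Hyp n) : IsC2At (coshDist p) x := by
  have hsqrt : ContDiffAt ℝ 2 (fun y : EuclideanSpace ℝ (Fin n) => √(1 + ‖y‖ ^ 2)) x.1.2 :=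
    (contDiffAt_const.add (contDiff_norm_sq ℝ).contDiffAt).sqrt (by positivity)
  exact ((contDiffAt_const.inner ℝ contDiffAt_id).sub (contDiffAt_const.mul hsqrt)).neg

theorem mink_eq_zero_of_tlen_eq_zero (p : Hyp n) {x : Hyp n} {X : tangentSpace x}
    (h : tlen X = 0) : -mink p.1 X.1 = 0 := by
  rw [eq_zero_of_tlen_eq_zero h, Submodule.coe_zero, mink_zero_right, neg_zero]

theorem dirDeriv_coshDist (p : Hyp n) {x : Hyp n} (X : tangentSpace x) :
    dirDeriv (coshDist p) x X = -mink p.1 X.1 := by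
  simp only [dirDeriv, coshDist_hexp]
  exact deriv_cosh_smul_add_sinh_smul (mink_eq_zero_of_tlen_eq_zero p)

theorem hessQuad_coshDist (p : Hyp n) {x : Hyp n} (X : tangentSpace x) :
    hessQuad (coshDist p) x X = mink X.1 X.1 * coshDist p x := by
  simp only [hessQuad, coshDist_hexp]
  rw [iteratedDeriv_two_cosh_smul_add_sinh_smul (mink_eq_zero_of_tlen_eq_zero p), tlen_sq,
    smul_eq_mul]

/-- The Laplacian of the radial function `h ∘ coshDist p` at the points with `coshDist p = s`. -/
noncomputable def coshLaplacian (n : ℕ) (h : ℝ → ℝ) (s : ℝ) : ℝ :=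
  iteratedDeriv 2 h s * (s ^ 2 - 1) + n * (s * deriv h s)

theorem laplaceBeltrami_comp_coshDist {h : ℝ → ℝ} {p x : Hyp n}
    (hh : ContDiffAt ℝ 2 h (coshDist p x)) :
    laplaceBeltrami (fun y => h (coshDist p y)) x = coshLaplacian n h (coshDist p x) := by
  simp only [laplaceBeltrami_eq_sum, hessQuad_comp hh (isC2At_coshDist p x), dirDeriv_coshDist,
    hessQuad_coshDist, frame_orthonormal, neg_sq, Finset.sum_add_distrib, ← Finset.mul_sum,
    sum_mink_center_frame_sq, coshLaplacian, if_true, one_mul, Finset.sum_const,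
    Finset.card_univ, Fintype.card_fin, nsmul_eq_mul]
  ring

theorem isC2At_hdist {p x : Hyp n} (h : x ≠ p) : IsC2At (hdist p) x :=
  (isC2At_coshDist p x).comp (Real.contDiffAt_arcosh (one_lt_coshDist h))

theorem dirDeriv_hdist {p x : Hyp n} (h : x ≠ p) (X : tangentSpace x) :
    dirDeriv (hdist p) x X = -mink p.1 X.1 / Real.sinh (hdist p x) := by
  have hchain := dirDeriv_comp Real.differentiable_cosh.differentiableAt (isC2At_hdist h) X
  simp only [cosh_hdist, dirDeriv_coshDist, Real.deriv_cosh] at hchain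
  rw [hchain, mul_div_cancel_left₀ _ (Real.sinh_pos_iff.2 (hdist_pos h)).ne']

theorem hessQuad_hdist {p x : Hyp n} (h : x ≠ p) (X : tangentSpace x) :
    hessQuad (hdist p) x X = Real.cosh (hdist p x) / Real.sinh (hdist p x) *
      (mink X.1 X.1 - dirDeriv (hdist p) x X ^ 2) := by
  have hchain := hessQuad_comp Real.contDiff_cosh.contDiffAt (isC2At_hdist h) X
  have hcosh : iteratedDeriv 2 Real.cosh = Real.cosh := by
    rw [iteratedDeriv_succ, iteratedDeriv_one, Real.deriv_cosh, Real.deriv_sinh]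
  simp only [cosh_hdist, hessQuad_coshDist, Real.deriv_cosh, hcosh] at hchain
  have hsinh := (Real.sinh_pos_iff.2 (hdist_pos h)).ne'
  rw [cosh_hdist]
  field_simp
  linear_combination -hchain

theorem sum_dirDeriv_hdist_sq {p x : Hyp n} (h : x ≠ p) :
    ∑ i, dirDeriv (hdist p) x (frame x i) ^ 2 = 1 := by
  have hsinh := (Real.sinh_pos_iff.2 (hdist_pos h)).ne'
  simp only [dirDeriv_hdist h, div_pow, neg_sq, ← Finset.sum_div, sum_mink_center_frame_sq,
    ← cosh_hdist, ← Real.sinh_sq]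
  exact div_self (pow_ne_zero 2 hsinh)

theorem hessQuad_comp_hdist {k : ℝ → ℝ} {p x : Hyp n} (hx : x ≠ p)
    (hk : ContDiffAt ℝ 2 k (hdist p x)) (X : tangentSpace x) :
    hessQuad (fun y => k (hdist p y)) x X =
      (iteratedDeriv 2 k (hdist p x) -
          deriv k (hdist p x) * (Real.cosh (hdist p x) / Real.sinh (hdist p x))) *
        dirDeriv (hdist p) x X ^ 2 +
      deriv k (hdist p x) * (Real.cosh (hdist p x) / Real.sinh (hdist p x)) * mink X.1 X.1 := by
  rw [hessQuad_comp hk (isC2At_hdist hx), hessQuad_hdist hx]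
  ring

/-! ### Boundary points of geodesic balls -/

theorem mem_closure_coshDist_lt {p x : Hyp n} (hx : x ≠ p) :
    x ∈ closure {y | coshDist p y < coshDist p x} := by
  have hderiv := (isC2At_coshDist p x).hasDerivAt_comp_hexp (radialVector p x)
  rw [dirDeriv_coshDist, mink_center_radialVector, neg_sub] at hderiv
  have hneg : 1 - coshDist p x ^ 2 < 0 := by nlinarith [one_lt_coshDist hx]
  have hlt : ∀ᶠ t in 𝓝[>] (0 : ℝ), coshDist p (hexp x (t • radialVector p x)) < coshDist p x := by
    filter_upwards [hderiv.tendsto_slope_zero_right.eventually_lt_const hneg,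
      self_mem_nhdsWithin] with t hslope ht
    rw [zero_add, hexp_zero_smul, smul_eq_mul] at hslope
    exact sub_neg.1 ((pos_iff_neg_of_mul_neg hslope).1 (inv_pos.2 ht))
  exact mem_closure_of_tendsto ((tendsto_hexp _).mono_left nhdsWithin_le_nhds) hlt

theorem mem_closure_geodesicBall {p x : Hyp n} {r : ℝ} (hr : 0 < r)
    (hx : coshDist p x ≤ Real.cosh r) : x ∈ closure (geodesicBall p r) := by
  rw [geodesicBall_eq p hr]
  rcases hx.lt_or_eq with hlt | heq
  · exact subset_closure hlt
  · have hne : x ≠ p := by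
      rintro rfl
      exact (Real.one_lt_cosh.2 hr.ne').ne (coshDist_self x ▸ heq)
    exact heq ▸ mem_closure_coshDist_lt hne

theorem mem_frontier_geodesicBall {p x : Hyp n} {r : ℝ} (hr : 0 < r)
    (hx : coshDist p x = Real.cosh r) : x ∈ frontier (geodesicBall p r) := by
  refine ⟨mem_closure_geodesicBall hr hx.le, ?_⟩
  rw [geodesicBall_eq p hr, (isOpen_coshDist_lt p _).interior_eq, mem_ofPred_eq, hx]
  exact lt_irrefl _

/-! ### Reflections -/

/-- The Lorentz reflection of Minkowski space in the hyperplane orthogonal to `N` (the identity if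
`N` is lightlike). -/
noncomputable def reflection (N z : Mink n) : Mink n := z - (2 * mink z N / mink N N) • N

theorem mink_reflection (N z w : Mink n) :
    mink (reflection N z) (reflection N w) = mink z w := by
  simp only [reflection, mink_sub_left, mink_sub_right, mink_smul_left, mink_smul_right,
    mink_comm N w]
  rcases eq_or_ne (mink N N) 0 with h | h
  · simp only [h, div_zero, zero_mul, sub_zero]
  · field_simp
    ring

theorem reflection_eq_self {N z : Mink n} (h : mink z N = 0) : reflection N z = z := by
  rw [reflection, h, mul_zero, zero_div, zero_smul, sub_zero]

theorem mink_reflection_of_orthogonal {N z : Mink n} (h : mink z N = 0) (w : Mink n) :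
    mink z (reflection N w) = mink z w := by
  conv_lhs => rw [← reflection_eq_self h, mink_reflection]

theorem fst_pos_of_mink_neg {p : Hyp n} {w : Mink n} (hw : mink w w = -1)
    (hpw : mink p.1 w < 0) : 0 < w.1 := by
  by_contra! hneg
  have hnorm : ‖w.2‖ ≤ -w.1 := by
    rw [mink, real_inner_self_eq_norm_sq] at hw
    exact le_of_sq_le_sq (by linarith) (by linarith)
  have hcs : -(‖p.1.2‖ * ‖w.2‖) ≤ inner ℝ p.1.2 w.2 := neg_le_of_abs_le (abs_real_inner_le_norm _ _)
  rw [mink] at hpw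
  nlinarith [norm_snd_lt_fst p, norm_nonneg p.1.2]

theorem reflection_mem {N : Mink n} {p : Hyp n} (hp : mink p.1 N = 0) (z : Hyp n) :
    mink (reflection N z.1) (reflection N z.1) = -1 ∧ 0 < (reflection N z.1).1 := by
  have hself : mink (reflection N z.1) (reflection N z.1) = -1 := by rw [mink_reflection, z.2.1]
  refine ⟨hself, fst_pos_of_mink_neg (p := p) hself ?_⟩
  rw [mink_reflection_of_orthogonal hp]
  exact neg_pos.1 (one_pos.trans_le (one_le_coshDist p z))

section

variable {N : Mink n} {p : Hyp n} (hp : mink p.1 N = 0)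

/-- The reflection of hyperbolic space in the hyperplane orthogonal to `N`, which passes
through `p`. -/
noncomputable def hypReflection (z : Hyp n) : Hyp n := ⟨reflection N z.1, reflection_mem hp z⟩

theorem hypReflection_center : hypReflection hp p = p := Subtype.ext (reflection_eq_self hp)

theorem coshDist_hypReflection (z : Hyp n) : coshDist p (hypReflection hp z) = coshDist p z :=
  congrArg Neg.neg (mink_reflection_of_orthogonal hp z.1)

theorem continuous_hypReflection : Continuous (hypReflection hp) := by
  refine Continuous.subtype_mk (f := fun z : Hyp n => reflection N z.1) ?_ _
  have := continuous_val (n := n)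
  unfold reflection mink
  fun_prop

/-- The differential of `hypReflection`. -/
noncomputable def tangentReflection {z : Hyp n} (X : tangentSpace z) :
    tangentSpace (hypReflection hp z) :=
  ⟨reflection N X.1, (mink_reflection N z.1 X.1).trans X.2⟩

theorem mink_tangentReflection {z : Hyp n} (X Y : tangentSpace z) :
    mink (tangentReflection hp X).1 (tangentReflection hp Y).1 = mink X.1 Y.1 :=
  mink_reflection N X.1 Y.1

theorem hypReflection_hexp {z : Hyp n} (t : ℝ) (X : tangentSpace z) :
    hypReflection hp (hexp z (t • X)) = hexp (hypReflection hp z) (t • tangentReflection hp X) := by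
  apply Subtype.ext
  rw [hexp_smul, tlen, mink_tangentReflection, ← tlen]
  simp only [hypReflection, tangentReflection, hexp_smul, reflection, mink_add_left, mink_smul_left]
  module

theorem hessQuad_comp_hypReflection (f : Hyp n → ℝ) {z : Hyp n} (X : tangentSpace z) :
    hessQuad (fun y => f (hypReflection hp y)) z X =
      hessQuad f (hypReflection hp z) (tangentReflection hp X) := by
  simp only [hessQuad, hypReflection_hexp]

theorem IsC2At.comp_hypReflection {f : Hyp n → ℝ} {z : Hyp n}
    (hf : IsC2At f (hypReflection hp z)) : IsC2At (fun y => f (hypReflection hp y)) z := by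
  have hfactor : (fun y => f (hypReflection hp (chart y))) =
      (fun y => f (chart y)) ∘ fun y => (reflection N (chart y).1).2 := by
    ext y
    exact congrArg f (chart_snd (hypReflection hp (chart y))).symm
  have hsqrt : ContDiff ℝ 2 fun y : EuclideanSpace ℝ (Fin n) => √(1 + ‖y‖ ^ 2) :=
    (contDiff_const.add (contDiff_norm_sq ℝ)).sqrt fun y => by positivity
  have hinner : ContDiff ℝ 2 fun y : EuclideanSpace ℝ (Fin n) => (inner ℝ y N.2 : ℝ) :=
    contDiff_id.inner ℝ contDiff_const
  rw [IsC2At, hfactor]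
  refine ContDiffAt.comp z.1.2 (by rwa [chart_snd]) (ContDiff.contDiffAt ?_)
  unfold reflection chart mink
  simp only [Prod.snd_sub, Prod.smul_snd]
  fun_prop

theorem laplaceBeltrami_comp_hypReflection {f : Hyp n → ℝ} {z : Hyp n}
    (hf : IsC2At f (hypReflection hp z)) :
    laplaceBeltrami (fun y => f (hypReflection hp y)) z =
      laplaceBeltrami f (hypReflection hp z) := by
  rw [laplaceBeltrami_eq_sum, laplaceBeltrami_eq_sum_of_orthonormal hf
    (E := fun i => tangentReflection hp (frame z i)) fun i j => by
      rw [mink_tangentReflection, frame_orthonormal]]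
  simp only [hessQuad_comp_hypReflection]

end

theorem mink_sub_self (x y : Hyp n) : mink (x.1 - y.1) (x.1 - y.1) = 2 * (coshDist x y - 1) := by
  rw [mink_sub_left, mink_sub_right, mink_sub_right, x.2.1, y.2.1, mink_comm y.1, coshDist]
  ring

/-- The mirror is the bisector of `x` and `y`. -/
theorem exists_hypReflection_eq {p x y : Hyp n} (h : coshDist p x = coshDist p y) :
    ∃ (N : Mink n) (hp : mink p.1 N = 0), hypReflection hp x = y := by
  refine ⟨x.1 - y.1, by rw [mink_sub_right]; exact sub_eq_zero.2 (neg_injective h),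
    Subtype.ext ?_⟩
  rcases eq_or_ne y x with rfl | hne
  · change y.1 - _ • (y.1 - y.1) = y.1
    rw [sub_self, smul_zero, sub_zero]
  · have hcoef : 2 * mink x.1 (x.1 - y.1) / mink (x.1 - y.1) (x.1 - y.1) = 1 := by
      have hpos := one_lt_coshDist hne
      rw [mink_sub_self, div_eq_one_iff_eq (by linarith), mink_sub_right, x.2.1, coshDist]
      ring
    change x.1 - (2 * mink x.1 (x.1 - y.1) / mink (x.1 - y.1) (x.1 - y.1)) • (x.1 - y.1) = y.1
    rw [hcoef, one_smul, sub_sub_cancel]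

/-! ### The maximum principle -/

/-- At a negative minimum of `Z / H`, of value `m`, the function `Z - m H` has a local minimum,
which the inequality between the Laplacians rules out. -/
theorem nonneg_of_laplaceBeltrami_mul_lt {K : Set (Hyp n)} (hK : IsCompact K) {Z H : Hyp n → ℝ}
    (hZ : ContinuousOn Z K) (hH : ContinuousOn H K) (hpos : ∀ x ∈ K, 0 < H x)
    (hnhds : ∀ x ∈ K, Z x < 0 → K ∈ 𝓝 x) (hZ₂ : ∀ x ∈ K, Z x < 0 → IsC2At Z x)
    (hH₂ : ∀ x ∈ K, Z x < 0 → IsC2At H x)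
    (hlap : ∀ x ∈ K, Z x < 0 → laplaceBeltrami Z x * H x < Z x * laplaceBeltrami H x) :
    ∀ x ∈ K, 0 ≤ Z x := by
  intro x hx
  by_contra! hneg
  obtain ⟨y, hy, hmin⟩ := hK.exists_isMinOn ⟨x, hx⟩ (hZ.div hH fun z hz => (hpos z hz).ne')
  set m := Z y / H y with hm
  have hZy : Z y = m * H y := by rw [hm, div_mul_cancel₀ _ (hpos y hy).ne']
  have hm0 : m < 0 := (hmin hx).trans_lt (div_neg_of_neg_of_pos hneg (hpos x hx))
  have hy0 : Z y < 0 := hZy ▸ mul_neg_of_neg_of_pos hm0 (hpos y hy)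
  have hlocal : IsLocalMin (fun z => Z z - m * H z) y := by
    filter_upwards [hnhds y hy hy0] with z hz
    rw [hZy, sub_self, sub_nonneg, ← le_div_iff₀ (hpos z hz)]
    exact hmin hz
  have hnonneg := laplaceBeltrami_nonneg_of_isLocalMin
    ((hZ₂ y hy hy0).sub_const_mul (hH₂ y hy hy0) m) hlocal
  rw [laplaceBeltrami_sub_const_mul (hZ₂ y hy hy0) (hH₂ y hy hy0)] at hnonneg
  have hlt := hlap y hy hy0
  rw [hZy] at hlt
  nlinarith [hpos y hy]

theorem nonneg_on_shell {p : Hyp n} {s₁ S : ℝ} {Z : Hyp n → ℝ} {h : ℝ → ℝ}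
    (hZ : ContinuousOn Z {x | coshDist p x ≤ S}) (hZ₂ : ∀ x, coshDist p x < S → IsC2At Z x)
    (hh : ContDiff ℝ 2 h) (hpos : ∀ s ∈ Icc s₁ S, 0 < h s)
    (hin : ∀ x, coshDist p x = s₁ → 0 ≤ Z x) (hout : ∀ x, coshDist p x = S → 0 ≤ Z x)
    (hlap : ∀ x, coshDist p x ∈ Ioo s₁ S → Z x < 0 →
      laplaceBeltrami Z x * h (coshDist p x) < Z x * coshLaplacian n h (coshDist p x)) :
    ∀ x, coshDist p x ∈ Icc s₁ S → 0 ≤ Z x := by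
  have hcont := continuous_coshDist p
  have hmem : ∀ x, coshDist p x ∈ Icc s₁ S → Z x < 0 → coshDist p x ∈ Ioo s₁ S := fun x hx hneg =>
    ⟨hx.1.lt_of_ne fun h => (hin x h.symm).not_gt hneg,
      hx.2.lt_of_ne fun h => (hout x h).not_gt hneg⟩
  have hK : IsCompact (coshDist p ⁻¹' Icc s₁ S) :=
    (isCompact_coshDist_le p S).of_isClosed_subset (isClosed_Icc.preimage hcont) fun _ hx => hx.2
  refine nonneg_of_laplaceBeltrami_mul_lt hK (H := fun x => h (coshDist p x))
    (hZ.mono fun _ hx => hx.2) (hh.continuous.comp hcont).continuousOn (fun x hx => hpos _ hx)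
    (fun x hx hneg => hcont.continuousAt.preimage_mem_nhds (Icc_mem_nhds_iff.2 (hmem x hx hneg)))
    (fun x hx hneg => hZ₂ x (hmem x hx hneg).2)
    (fun x _ _ => (isC2At_coshDist p x).comp hh.contDiffAt) fun x hx hneg => ?_
  rw [laplaceBeltrami_comp_coshDist hh.contDiffAt]
  exact hlap x (hmem x hx hneg) hneg

/-! ### Barriers -/

theorem coshLaplacian_eq {h h' h'' : ℝ → ℝ} (hh : ∀ s, HasDerivAt h (h' s) s)
    (hh' : ∀ s, HasDerivAt h' (h'' s) s) (s : ℝ) :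
    coshLaplacian n h s = h'' s * (s ^ 2 - 1) + n * (s * h' s) := by
  rw [coshLaplacian, iteratedDeriv_succ, iteratedDeriv_one, funext fun s => (hh s).deriv,
    (hh' s).deriv]

theorem exists_coshLaplacian_pos (n : ℕ) {s₁ : ℝ} (hs₁ : 1 < s₁) (S : ℝ) :
    ∃ b : ℝ → ℝ, ContDiff ℝ 2 b ∧ b S = 0 ∧ (∀ s < S, 0 < b s) ∧
      ∀ s ∈ Icc s₁ S, 0 < coshLaplacian n b s := by
  have hs₁sq : 0 < s₁ ^ 2 - 1 := by nlinarith
  obtain ⟨k, hk⟩ := exists_gt (max 0 (n * S / (s₁ ^ 2 - 1)))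
  obtain ⟨hk0, hkS⟩ := max_lt_iff.1 hk
  rw [div_lt_iff₀ hs₁sq] at hkS
  have hexp : ∀ s, HasDerivAt (fun s => Real.exp (-k * s)) (-k * Real.exp (-k * s)) s := fun s =>
    (((hasDerivAt_id' s).const_mul (-k)).exp).congr_deriv (by ring)
  refine ⟨fun s => Real.exp (-k * s) - Real.exp (-k * S), by fun_prop, sub_self _, fun s hs => ?_,
    fun s hs => ?_⟩
  · rw [sub_pos, Real.exp_lt_exp]
    nlinarith
  · have hdom : n * s < k * (s ^ 2 - 1) := by
      have hnS : (n : ℝ) * s ≤ n * S := mul_le_mul_of_nonneg_left hs.2 n.cast_nonneg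
      have hk₁ : k * (s₁ ^ 2 - 1) ≤ k * (s ^ 2 - 1) := by
        gcongr
        exact hs.1
      linarith
    rw [coshLaplacian_eq (fun s => (hexp s).sub_const _) fun s => (hexp s).const_mul (-k)]
    have hfactor : -k * (-k * Real.exp (-k * s)) * (s ^ 2 - 1) +
        n * (s * (-k * Real.exp (-k * s))) =
          k * Real.exp (-k * s) * (k * (s ^ 2 - 1) - n * s) := by ring
    rw [hfactor]
    exact mul_pos (mul_pos hk0 (Real.exp_pos _)) (sub_pos.2 hdom)

theorem exists_coshLaplacian_lt (n : ℕ) {S : ℝ} (hS : 1 < S) (μ : ℝ) :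
    ∃ s₁ < S, ∃ h : ℝ → ℝ, ContDiff ℝ 2 h ∧
      ∀ s ∈ Icc s₁ S, 0 < h s ∧ coshLaplacian n h s < -μ * h s := by
  have hSsq : S ^ 2 - 1 ≠ 0 := by nlinarith
  -- The value of `K` makes the Laplacian of `h` equal to `-(μ + 1)` at `S`, where `h S = 1`.
  set K := (μ + 1) / (2 * (S ^ 2 - 1))
  set h : ℝ → ℝ := fun s => 1 - K * (S - s) ^ 2
  have hh : ∀ s, HasDerivAt h (2 * K * (S - s)) s := fun s =>
    (((((hasDerivAt_id' s).const_sub S).pow 2).const_mul K).const_sub 1).congr_deriv (by ring)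
  have hh' : ∀ s, HasDerivAt (fun s => 2 * K * (S - s)) (-(2 * K)) s := fun s =>
    (((hasDerivAt_id' s).const_sub S).const_mul (2 * K)).congr_deriv (by ring)
  have hlap := coshLaplacian_eq (n := n) hh hh'
  have hpos : ∀ᶠ s in 𝓝[≤] S, 0 < h s := by
    refine Filter.Eventually.filter_mono nhdsWithin_le_nhds (ContinuousAt.eventually_lt
      continuousAt_const (hh S).continuousAt ?_)
    simp only [h, sub_self]
    norm_num
  have hlt : ∀ᶠ s in 𝓝[≤] S, coshLaplacian n h s < -μ * h s := by
    simp only [hlap]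
    refine Filter.Eventually.filter_mono nhdsWithin_le_nhds (ContinuousAt.eventually_lt
      (by fun_prop) (by fun_prop) ?_)
    have hKS : K * (2 * (S ^ 2 - 1)) = μ + 1 := div_mul_cancel₀ _ (mul_ne_zero two_ne_zero hSsq)
    simp only [h, sub_self]
    linarith
  obtain ⟨s₁, hs₁, hsub⟩ := mem_nhdsLE_iff_exists_Icc_subset.1 (hpos.and hlt)
  exact ⟨s₁, hs₁, h, by fun_prop, hsub⟩

/-! ### Positive Dirichlet solutions are radial -/

/-- `w` solves `Δw = -μ w` in the ball `coshDist p < S` and vanishes on its boundary sphere. -/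
structure IsDirichletSolution (p : Hyp n) (S μ : ℝ) (w : Hyp n → ℝ) : Prop where
  c2 : ∀ x, coshDist p x < S → IsC2At w x
  cont : ContinuousOn w {x | coshDist p x ≤ S}
  eqn : ∀ x, coshDist p x < S → laplaceBeltrami w x = -μ * w x
  bdry : ∀ x, coshDist p x = S → w x = 0

theorem IsDirichletEigenfunction.isDirichletSolution {p : Hyp n} {r μ : ℝ} {v : Hyp n → ℝ}
    (hr : 0 < r) (h : IsDirichletEigenfunction (geodesicBall p r) μ v) :
    IsDirichletSolution p (Real.cosh r) μ v where
  c2 x hx := by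
    rw [geodesicBall_eq p hr] at h
    exact h.c2.isC2At (isOpen_coshDist_lt p _) hx
  cont := h.cont.mono fun _ hx => mem_closure_geodesicBall hr hx
  eqn x hx := h.eqn x (by rwa [geodesicBall_eq p hr])
  bdry x hx := h.bdry x (mem_frontier_geodesicBall hr hx)

theorem exists_coshDist_le_subset {p : Hyp n} {U : Set (Hyp n)} (hU : U ∈ 𝓝 p) :
    ∃ s₁ > 1, {x | coshDist p x ≤ s₁} ⊆ U := by
  have : Nonempty (Ioi (1 : ℝ)) := nonempty_Ioi_subtype
  obtain ⟨s₁, hs₁⟩ := exists_subset_nhds_of_isCompact'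
    (V := fun s : Ioi (1 : ℝ) => {x | coshDist p x ≤ s})
    (Monotone.directed_ge fun s t hst x (hx : coshDist p x ≤ s) => hx.trans hst)
    (fun s => isCompact_coshDist_le p s)
    (fun s => isClosed_le (continuous_coshDist p) continuous_const) (U := U) fun x hx => by
      have hle : coshDist p x ≤ 1 := le_of_forall_gt_imp_ge_of_dense fun s hs =>
        mem_iInter.1 hx ⟨s, hs⟩
      obtain rfl : x = p := by_contra fun hne => (one_lt_coshDist hne).not_ge hle
      exact hU
  exact ⟨s₁, s₁.2, hs₁⟩

theorem exists_const_mul_le_of_isCompact {X : Type*} [TopologicalSpace X] {K : Set X}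
    (hK : IsCompact K) {f g : X → ℝ} (hf : ContinuousOn f K) (hg : ContinuousOn g K)
    (hpos : ∀ x ∈ K, 0 < g x) : ∃ ε > 0, ∀ x ∈ K, ε * f x ≤ g x := by
  obtain ⟨C, hC⟩ := hK.exists_bound_of_continuousOn (hf.div hg fun x hx => (hpos x hx).ne')
  have hC1 : 0 < max C 1 := one_pos.trans_le (le_max_right C 1)
  refine ⟨(max C 1)⁻¹, inv_pos.2 hC1, fun x hx => (inv_mul_le_iff₀ hC1).2 ?_⟩
  rw [← div_le_iff₀ (hpos x hx)]
  exact (le_abs_self _).trans ((hC x hx).trans (le_max_left C 1))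

namespace IsDirichletSolution

variable {p : Hyp n} {S μ : ℝ} {u v w : Hyp n → ℝ}

theorem sub_const_mul (hw : IsDirichletSolution p S μ w) (hu : IsDirichletSolution p S μ u)
    (c : ℝ) : IsDirichletSolution p S μ (fun x => w x - c * u x) where
  c2 x hx := (hw.c2 x hx).sub_const_mul (hu.c2 x hx) c
  cont := hw.cont.sub (continuousOn_const.mul hu.cont)
  eqn x hx := by
    rw [laplaceBeltrami_sub_const_mul (hw.c2 x hx) (hu.c2 x hx), hw.eqn x hx, hu.eqn x hx]
    ring
  bdry x hx := by rw [hw.bdry x hx, hu.bdry x hx, mul_zero, sub_zero]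

theorem comp_hypReflection (hw : IsDirichletSolution p S μ w) {N : Mink n} (hp : mink p.1 N = 0) :
    IsDirichletSolution p S μ (fun x => w (hypReflection hp x)) where
  c2 x hx := (hw.c2 _ (by rwa [coshDist_hypReflection])).comp_hypReflection hp
  cont := hw.cont.comp (continuous_hypReflection hp).continuousOn fun x hx => by
    rwa [mem_ofPred_eq, coshDist_hypReflection]
  eqn x hx := by
    have hx' : coshDist p (hypReflection hp x) < S := by rwa [coshDist_hypReflection]
    rw [laplaceBeltrami_comp_hypReflection hp (hw.c2 _ hx'), hw.eqn _ hx']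
  bdry x hx := hw.bdry _ (by rwa [coshDist_hypReflection])

/-- Otherwise `c - coshDist p` is a strict supersolution, and comparison with it gives `-v ≥ 0`. -/
theorem le_eigenvalue_mul (hv : IsDirichletSolution p S μ v) (hS : 1 < S)
    (hpos : ∀ x, coshDist p x < S → 0 < v x) {c : ℝ} (hc : S < c) : n ≤ μ * (c - 1) := by
  by_contra! hlt
  have hneg := hv.sub_const_mul hv 2
  have hlap : ∀ s, coshLaplacian n (fun s => c - s) s = -(n * s) := fun s => by
    rw [coshLaplacian_eq (fun s => (hasDerivAt_id' s).const_sub c) fun s => hasDerivAt_const s _]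
    ring
  have hcomp := nonneg_on_shell (s₁ := 0) (h := fun s => c - s) hneg.cont hneg.c2 (by fun_prop)
    (fun s hs => by linarith [hs.2])
    (fun x hx => absurd (one_le_coshDist p x) (by rw [hx]; norm_num))
    (fun x hx => (hneg.bdry x hx).ge) (fun x hx _ => ?_) p
    (by rw [coshDist_self]; exact ⟨zero_le_one, hS.le⟩)
  · linarith [hpos p (by rwa [coshDist_self])]
  · rw [hneg.eqn x hx.2, hlap]
    have hs := one_le_coshDist p x
    have hn : (n : ℝ) ≤ n * coshDist p x := le_mul_of_one_le_right n.cast_nonneg hs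
    have hsuper : μ * (c - coshDist p x) < n * coshDist p x := by
      rcases le_or_gt 0 μ with _ | _
      · nlinarith
      · nlinarith [hx.2]
    nlinarith [hpos x hx.2]

theorem pos_of_center_pos (hw : IsDirichletSolution p S μ w) (hS : 1 < S) (hμ : 0 ≤ μ)
    (hnonneg : ∀ x, coshDist p x < S → 0 ≤ w x) (hp : 0 < w p) (x : Hyp n)
    (hx : coshDist p x < S) : 0 < w x := by
  have hpS : coshDist p p < S := by rwa [coshDist_self]
  have hcont : ContinuousAt w p := hw.cont.continuousAt
    (mem_of_superset ((isOpen_coshDist_lt p S).mem_nhds hpS) fun y (hy : coshDist p y < S) => hy.le)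
  obtain ⟨s₁, hs₁, hsub⟩ := exists_coshDist_le_subset (hcont.eventually_const_lt (half_lt_self hp))
  rcases le_or_gt (coshDist p x) s₁ with hle | hgt
  · exact (half_pos hp).trans (hsub hle)
  obtain ⟨b, hb, hbS, hbpos, hblap⟩ := exists_coshLaplacian_pos n hs₁ S
  have hb₁ := hbpos s₁ (hgt.trans hx)
  set ε := w p / 2 / b s₁
  have hε0 : 0 < ε := div_pos (half_pos hp) hb₁
  have hεb : ε * b s₁ = w p / 2 := div_mul_cancel₀ _ hb₁.ne'
  have hb₂ : ∀ y, IsC2At (fun y => b (coshDist p y)) y := fun y =>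
    (isC2At_coshDist p y).comp hb.contDiffAt
  have hcomp : 0 ≤ w x - ε * b (coshDist p x) := by
    refine nonneg_on_shell (Z := fun y => w y - ε * b (coshDist p y)) (h := fun _ => 1)
      (hw.cont.sub (continuousOn_const.mul
        (hb.continuous.comp (continuous_coshDist p)).continuousOn))
      (fun y hy => (hw.c2 y hy).sub_const_mul (hb₂ y) ε) contDiff_const (fun _ _ => one_pos)
      (fun y hy => ?_) (fun y hy => ?_) (fun y hy _ => ?_) x ⟨hgt.le, hx.le⟩
    · rw [hy, hεb, sub_nonneg]
      exact le_of_lt (hsub hy.le)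
    · rw [hw.bdry y hy, hy, hbS, mul_zero, sub_zero]
    · rw [laplaceBeltrami_sub_const_mul (hw.c2 y hy.2) (hb₂ y), hw.eqn y hy.2,
        laplaceBeltrami_comp_coshDist hb.contDiffAt,
        coshLaplacian_eq (fun s => hasDerivAt_const s _) fun s => hasDerivAt_const s _]
      linarith [mul_nonneg hμ (hnonneg y hy.2), mul_pos hε0 (hblap _ ⟨hy.1.le, hy.2.le⟩)]
  linarith [mul_pos hε0 (hbpos _ hx)]

theorem exists_const_mul_le (hw : IsDirichletSolution p S μ w) (hu : IsDirichletSolution p S μ u)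
    (hS : 1 < S) (hpos : ∀ x, coshDist p x < S → 0 < w x) :
    ∃ ε > 0, ∀ x, coshDist p x < S → ε * u x ≤ w x := by
  obtain ⟨s₁, hs₁, h, hh, hsuper⟩ := exists_coshLaplacian_lt n hS μ
  have hsub : {x | coshDist p x ≤ s₁} ⊆ {x | coshDist p x ≤ S} := fun x hx => hx.trans hs₁.le
  obtain ⟨ε, hε, hinner⟩ := exists_const_mul_le_of_isCompact (isCompact_coshDist_le p s₁)
    (hu.cont.mono hsub) (hw.cont.mono hsub) fun x hx => hpos x (lt_of_le_of_lt hx hs₁)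
  refine ⟨ε, hε, fun x hx => ?_⟩
  rcases le_or_gt (coshDist p x) s₁ with hle | hgt
  · exact hinner x hle
  have hz := hw.sub_const_mul hu ε
  refine sub_nonneg.1 (nonneg_on_shell hz.cont hz.c2 hh (fun s hs => (hsuper s hs).1)
    (fun y hy => sub_nonneg.2 (hinner y hy.le)) (fun y hy => (hz.bdry y hy).ge)
    (fun y hy hneg => ?_) x ⟨hgt.le, hx.le⟩)
  rw [hz.eqn y hy.2]
  linarith [mul_lt_mul_of_neg_left (hsuper _ (Ioo_subset_Icc_self hy)).2 hneg]

/-- If the largest `t` with `t u ≤ v` were less than `1`, then `v - t u` would be positive at the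
centre, hence everywhere, and would dominate a multiple of `u`. -/
theorem le_of_center_eq (hv : IsDirichletSolution p S μ v) (hu : IsDirichletSolution p S μ u)
    (hS : 1 < S) (hμ : 0 ≤ μ) (hvpos : ∀ x, coshDist p x < S → 0 < v x)
    (hupos : ∀ x, coshDist p x < S → 0 < u x) (huv : u p = v p) (x : Hyp n)
    (hx : coshDist p x < S) : u x ≤ v x := by
  have hpS : coshDist p p < S := by rwa [coshDist_self]
  set T := {t : ℝ | ∀ x, coshDist p x < S → t * u x ≤ v x}
  have hT0 : (0 : ℝ) ∈ T := fun y hy => by rw [zero_mul]; exact (hvpos y hy).le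
  have hTbdd : BddAbove T := ⟨1, fun t ht =>
    (mul_le_iff_le_one_left (hupos p hpS)).1 (huv ▸ ht p hpS)⟩
  have hTclosed : IsClosed T := by
    simp only [T, ofPred_forall]
    exact isClosed_iInter fun y => isClosed_iInter fun _ => isClosed_le (by fun_prop) (by fun_prop)
  have hmem : sSup T ∈ T := hTclosed.csSup_mem ⟨0, hT0⟩ hTbdd
  suffices hge : 1 ≤ sSup T from
    (le_mul_of_one_le_left (hupos x hx).le hge).trans (hmem x hx)
  by_contra! hlt
  have hw := hv.sub_const_mul hu (sSup T)
  have hwp : 0 < v p - sSup T * u p := by rw [huv]; nlinarith [hvpos p hpS]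
  have hwpos := hw.pos_of_center_pos hS hμ (fun y hy => sub_nonneg.2 (hmem y hy)) hwp
  obtain ⟨ε, hε, hle⟩ := hw.exists_const_mul_le hu hS hwpos
  have hadd : sSup T + ε ∈ T := fun y hy => by linarith [hle y hy]
  linarith [le_csSup hTbdd hadd]

theorem le_of_coshDist_eq (hv : IsDirichletSolution p S μ v) (hS : 1 < S) (hμ : 0 ≤ μ)
    (hpos : ∀ x, coshDist p x < S → 0 < v x) {x y : Hyp n} (hxy : coshDist p x = coshDist p y)
    (hx : coshDist p x < S) : v y ≤ v x := by
  obtain ⟨N, hp, rfl⟩ := exists_hypReflection_eq hxy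
  exact hv.le_of_center_eq (hv.comp_hypReflection hp) hS hμ hpos
    (fun z hz => hpos _ (by rwa [coshDist_hypReflection])) (by rw [hypReflection_center]) x hx

theorem eq_of_coshDist_eq (hv : IsDirichletSolution p S μ v) (hS : 1 < S) (hμ : 0 ≤ μ)
    (hpos : ∀ x, coshDist p x < S → 0 < v x) {x y : Hyp n} (hxy : coshDist p x = coshDist p y)
    (hx : coshDist p x < S) : v x = v y :=
  le_antisymm (hv.le_of_coshDist_eq hS hμ hpos hxy.symm (hxy ▸ hx))
    (hv.le_of_coshDist_eq hS hμ hpos hxy hx)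

end IsDirichletSolution

/-! ### The Riccati equation of a logarithmic profile -/

theorem contDiffAt_deriv {f : ℝ → ℝ} {t : ℝ} (hf : ContDiffAt ℝ 2 f t) :
    ContDiffAt ℝ 1 (deriv f) t :=
  (hf.fderiv_right (m := 1) (by norm_num)).clm_apply contDiffAt_const

theorem hasDerivAt_deriv {f : ℝ → ℝ} {t : ℝ} (hf : ContDiffAt ℝ 2 f t) :
    HasDerivAt (deriv f) (iteratedDeriv 2 f t) t := by
  rw [iteratedDeriv_succ, iteratedDeriv_one]
  exact ((contDiffAt_deriv hf).differentiableAt one_ne_zero).hasDerivAt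

theorem continuousAt_iteratedDeriv_two {f : ℝ → ℝ} {t : ℝ} (hf : ContDiffAt ℝ 2 f t) :
    ContinuousAt (iteratedDeriv 2 f) t := by
  rw [iteratedDeriv_succ, iteratedDeriv_one]
  exact ((contDiffAt_deriv hf).fderiv_right (m := 0) (by norm_num)).continuousAt.clm_apply
    continuousAt_const

theorem hasDerivAt_sinh_pow (m : ℕ) {ρ : ℝ} (hρ : 0 < ρ) :
    HasDerivAt (fun ρ => Real.sinh ρ ^ m)
      (m * (Real.cosh ρ / Real.sinh ρ) * Real.sinh ρ ^ m) ρ := by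
  refine ((Real.hasDerivAt_sinh ρ).pow m).congr_deriv ?_
  have hsinh := (Real.sinh_pos_iff.2 hρ).ne'
  cases m with
  | zero => simp
  | succ m =>
    rw [Nat.add_sub_cancel, pow_succ]
    field_simp

theorem hasDerivAt_cosh_div_sinh {ρ : ℝ} (hρ : 0 < ρ) :
    HasDerivAt (fun ρ => Real.cosh ρ / Real.sinh ρ) (-(1 / Real.sinh ρ ^ 2)) ρ := by
  refine ((Real.hasDerivAt_cosh ρ).div (Real.hasDerivAt_sinh ρ)
    (Real.sinh_pos_iff.2 hρ).ne').congr_deriv ?_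
  rw [← neg_div]
  congr 1
  linear_combination -(Real.cosh_sq ρ)

theorem one_lt_inv_sinh_sq_sub_coth {ρ : ℝ} (hρ : 0 < ρ) (hsinh : Real.sinh ρ ≤ 1 / 2) :
    1 < 1 / Real.sinh ρ ^ 2 - Real.cosh ρ / Real.sinh ρ := by
  have hpos := Real.sinh_pos_iff.2 hρ
  have hcosh : Real.cosh ρ ≤ 6 / 5 := by
    refine le_of_sq_le_sq ?_ (by norm_num)
    rw [Real.cosh_sq]
    nlinarith
  have hsub : 1 / Real.sinh ρ ^ 2 - Real.cosh ρ / Real.sinh ρ =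
      (1 - Real.cosh ρ * Real.sinh ρ) / Real.sinh ρ ^ 2 := by
    field_simp
  rw [hsub, one_lt_div (by positivity)]
  nlinarith

theorem pos_of_integratingFactor {Q y a y' : ℝ → ℝ} {r : ℝ} (hQ : ContinuousOn Q (Ico 0 r))
    (hy : ContinuousOn y (Ico 0 r)) (h0 : Q 0 * y 0 = 0) (hQpos : ∀ ρ ∈ Ioo 0 r, 0 < Q ρ)
    (hQ' : ∀ ρ ∈ Ioo 0 r, HasDerivAt Q (a ρ * Q ρ) ρ) (hy' : ∀ ρ ∈ Ioo 0 r, HasDerivAt y (y' ρ) ρ)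
    (hpos : ∀ ρ ∈ Ioo 0 r, 0 < y' ρ + a ρ * y ρ) {ρ : ℝ} (hρ : ρ ∈ Ioo 0 r) : 0 < y ρ := by
  have hmono : StrictMonoOn (fun ρ => Q ρ * y ρ) (Ico 0 r) := by
    refine strictMonoOn_of_deriv_pos (convex_Ico 0 r) (hQ.mul hy) fun t ht => ?_
    rw [interior_Ico] at ht
    have hderiv := ((hQ' t ht).mul (hy' t ht)).deriv
    rw [show (fun ρ => Q ρ * y ρ) = Q * y from rfl, hderiv]
    linarith [mul_pos (hQpos t ht) (hpos t ht)]
  have hlt := hmono ⟨le_rfl, hρ.1.trans hρ.2⟩ (Ioo_subset_Ico_self hρ) hρ.1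
  simp only [h0] at hlt
  exact (pos_iff_pos_of_mul_pos hlt).1 (hQpos ρ hρ)

/-- `ℓ ∘ d(p, ·)` is the logarithm of a solution of `Δv = -μ v` in the ball of radius `r` about `p`
in `ℍ^{m+1}`; the equation away from the centre is a Riccati equation for `ℓ'`. -/
structure IsLogProfile (m : ℕ) (μ r : ℝ) (ℓ : ℝ → ℝ) : Prop where
  contDiffAt : ∀ ρ ∈ Ico 0 r, ContDiffAt ℝ 2 ℓ ρ
  deriv_zero : deriv ℓ 0 = 0
  riccati : ∀ ρ ∈ Ioo 0 r, iteratedDeriv 2 ℓ ρ + m * (Real.cosh ρ / Real.sinh ρ) * deriv ℓ ρ =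
    -μ - deriv ℓ ρ ^ 2

namespace IsLogProfile

variable {m : ℕ} {μ r : ℝ} {ℓ : ℝ → ℝ}

theorem continuousOn (h : IsLogProfile m μ r ℓ) : ContinuousOn ℓ (Ico 0 r) := fun ρ hρ =>
  (h.contDiffAt ρ hρ).continuousAt.continuousWithinAt

theorem continuousOn_deriv (h : IsLogProfile m μ r ℓ) : ContinuousOn (deriv ℓ) (Ico 0 r) :=
  fun ρ hρ => (contDiffAt_deriv (h.contDiffAt ρ hρ)).continuousAt.continuousWithinAt

theorem continuousOn_iteratedDeriv_two (h : IsLogProfile m μ r ℓ) :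
    ContinuousOn (iteratedDeriv 2 ℓ) (Ico 0 r) := fun ρ hρ =>
  (continuousAt_iteratedDeriv_two (h.contDiffAt ρ hρ)).continuousWithinAt

theorem hasDerivAt (h : IsLogProfile m μ r ℓ) {ρ : ℝ} (hρ : ρ ∈ Ioo 0 r) :
    HasDerivAt ℓ (deriv ℓ ρ) ρ :=
  ((h.contDiffAt ρ (Ioo_subset_Ico_self hρ)).differentiableAt two_ne_zero).hasDerivAt

theorem hasDerivAt_deriv (h : IsLogProfile m μ r ℓ) {ρ : ℝ} (hρ : ρ ∈ Ioo 0 r) :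
    HasDerivAt (deriv ℓ) (iteratedDeriv 2 ℓ ρ) ρ :=
  HypBall.hasDerivAt_deriv (h.contDiffAt ρ (Ioo_subset_Ico_self hρ))

theorem hasDerivAt_iteratedDeriv_two (h : IsLogProfile m μ r ℓ) {ρ : ℝ} (hρ : ρ ∈ Ioo 0 r) :
    HasDerivAt (iteratedDeriv 2 ℓ) (m * (1 / Real.sinh ρ ^ 2) * deriv ℓ ρ -
      (m * (Real.cosh ρ / Real.sinh ρ) + 2 * deriv ℓ ρ) * iteratedDeriv 2 ℓ ρ) ρ := by
  have hℓ' := h.hasDerivAt_deriv hρ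
  have hright : HasDerivAt
      (fun ρ => -μ - deriv ℓ ρ ^ 2 - m * (Real.cosh ρ / Real.sinh ρ) * deriv ℓ ρ) _ ρ :=
    ((hℓ'.pow 2).const_sub (-μ)).sub (((hasDerivAt_cosh_div_sinh hρ.1).const_mul (m : ℝ)).mul hℓ')
  refine (hright.congr_deriv (by push_cast; ring)).congr_of_eventuallyEq ?_
  filter_upwards [isOpen_Ioo.mem_nhds hρ] with t ht
  exact eq_sub_of_add_eq (h.riccati t ht)

theorem deriv_neg (h : IsLogProfile m μ r ℓ) (hμ : 0 < μ) {ρ : ℝ} (hρ : ρ ∈ Ioo 0 r) :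
    deriv ℓ ρ < 0 := by
  refine neg_pos.1 (pos_of_integratingFactor (Q := fun ρ => Real.sinh ρ ^ m)
    (y := fun ρ => -deriv ℓ ρ) (by fun_prop) h.continuousOn_deriv.neg ?_
    (fun t ht => pow_pos (Real.sinh_pos_iff.2 ht.1) m) (fun t ht => hasDerivAt_sinh_pow m ht.1)
    (fun t ht => (h.hasDerivAt_deriv ht).neg) (fun t ht => ?_) hρ)
  · rw [h.deriv_zero, neg_zero, mul_zero]
  · linarith [h.riccati t ht, sq_nonneg (deriv ℓ t)]

/-- For `m ≠ 0`, the function `y = ℓ' - ℓ''` satisfies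
`y' + (1 + 2ℓ' + m coth) y = ℓ' (1 + 2ℓ' - m (sinh⁻² - coth))`, whose right-hand side is positive,
and `e^{ρ + 2ℓ} sinh^m` is an integrating factor vanishing at `0`. -/
theorem iteratedDeriv_two_lt_deriv (h : IsLogProfile m μ r ℓ) (hμ : m + 1 ≤ μ)
    (hsinh : Real.sinh r ≤ 1 / 2) {ρ : ℝ} (hρ : ρ ∈ Ioo 0 r) :
    iteratedDeriv 2 ℓ ρ < deriv ℓ ρ := by
  obtain rfl | hm := Nat.eq_zero_or_pos m
  · have hriccati := h.riccati ρ hρ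
    rw [Nat.cast_zero] at hμ hriccati
    nlinarith [sq_nonneg (deriv ℓ ρ + 1 / 2)]
  have hm1 : (1 : ℝ) ≤ m := Nat.one_le_cast.2 hm
  have hexp : ∀ t ∈ Ioo 0 r, HasDerivAt (fun t => Real.exp (t + 2 * ℓ t))
      (Real.exp (t + 2 * ℓ t) * (1 + 2 * deriv ℓ t)) t := fun t ht =>
    ((hasDerivAt_id' t).add ((h.hasDerivAt ht).const_mul 2)).exp
  have hℓ := h.continuousOn
  refine sub_pos.1 (pos_of_integratingFactor
    (Q := fun t => Real.exp (t + 2 * ℓ t) * Real.sinh t ^ m)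
    (y := fun t => deriv ℓ t - iteratedDeriv 2 ℓ t)
    (a := fun t => 1 + 2 * deriv ℓ t + m * (Real.cosh t / Real.sinh t)) (by fun_prop)
    (h.continuousOn_deriv.sub h.continuousOn_iteratedDeriv_two) ?_
    (fun t ht => mul_pos (Real.exp_pos _) (pow_pos (Real.sinh_pos_iff.2 ht.1) m))
    (fun t ht => ((hexp t ht).mul (hasDerivAt_sinh_pow m ht.1)).congr_deriv (by ring))
    (fun t ht => (h.hasDerivAt_deriv ht).sub (h.hasDerivAt_iteratedDeriv_two ht))
    (fun t ht => ?_) hρ)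
  · rw [Real.sinh_zero, zero_pow hm.ne', mul_zero, zero_mul]
  · have hneg := h.deriv_neg (by linarith) ht
    have hone := one_lt_inv_sinh_sq_sub_coth ht.1 ((Real.sinh_lt_sinh.2 ht.2).le.trans hsinh)
    have hfactor :
        1 + 2 * deriv ℓ t - m * (1 / Real.sinh t ^ 2 - Real.cosh t / Real.sinh t) < 0 := by
      nlinarith
    linarith [mul_pos_of_neg_of_neg hneg hfactor]

end IsLogProfile

/-! ### Radial profiles -/

/-- `F = k ∘ d(p, ·)` in the ball of radius `r` about `p`, with `k` even: `ρ` is determined by the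
point only up to sign. -/
def HasRadialProfile (p : Hyp n) (r : ℝ) (F : Hyp n → ℝ) (k : ℝ → ℝ) : Prop :=
  ∀ x ρ, |ρ| < r → Real.cosh ρ = coshDist p x → F x = k ρ

theorem hdist_self (p : Hyp n) : hdist p p = 0 := by
  rw [← Real.cosh_injOn.eq_iff (hdist_nonneg p p) self_mem_Ici, cosh_hdist, coshDist_self,
    Real.cosh_zero]

theorem exists_tlen_eq_one (hn : 1 ≤ n) (p : Hyp n) : ∃ E : tangentSpace p, tlen E = 1 :=
  ⟨frame p ⟨0, hn⟩, by rw [tlen, frame_orthonormal, if_pos rfl, Real.sqrt_one]⟩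

theorem coshDist_hexp_of_tlen_eq_one {p : Hyp n} {E : tangentSpace p} (hE : tlen E = 1) (ρ : ℝ) :
    coshDist p (hexp p (ρ • E)) = Real.cosh ρ := by
  rw [coshDist_hexp_self, hE, mul_one]

theorem hdist_hexp_of_tlen_eq_one {p : Hyp n} {E : tangentSpace p} (hE : tlen E = 1) {ρ : ℝ}
    (hρ : 0 ≤ ρ) : hdist p (hexp p (ρ • E)) = ρ := by
  rw [← Real.cosh_injOn.eq_iff (hdist_nonneg _ _) hρ, cosh_hdist, coshDist_hexp_of_tlen_eq_one hE]

namespace HasRadialProfile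

variable {p x : Hyp n} {r : ℝ} {F : Hyp n → ℝ} {k : ℝ → ℝ}

theorem deriv_zero (h : HasRadialProfile p r F k) (hn : 1 ≤ n) (hr : 0 < r) : deriv k 0 = 0 := by
  obtain ⟨E, hE⟩ := exists_tlen_eq_one hn p
  have heven : (fun ρ => k (-ρ)) =ᶠ[𝓝 0] k := by
    filter_upwards [Ioo_mem_nhds (neg_lt_zero.2 hr) hr] with ρ hρ
    have hρr : |ρ| < r := abs_lt.2 hρ
    rw [← h (hexp p (ρ • E)) ρ hρr (coshDist_hexp_of_tlen_eq_one hE ρ).symm,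
      ← h (hexp p (ρ • E)) (-ρ) (by rwa [abs_neg])
        (by rw [Real.cosh_neg, coshDist_hexp_of_tlen_eq_one hE])]
  have hderiv := heven.deriv_eq
  rw [deriv_comp_neg, neg_zero] at hderiv
  linarith

theorem comp_hexp_center (h : HasRadialProfile p r F k) (hr : 0 < r) (X : tangentSpace p) :
    (fun t : ℝ => F (hexp p (t • X))) =ᶠ[𝓝 0] fun t => k (tlen X * t) := by
  have hsmall : ∀ᶠ t in 𝓝 (0 : ℝ), |tlen X * t| < r :=
    ContinuousAt.eventually_lt (by fun_prop) continuousAt_const (by rwa [mul_zero, abs_zero])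
  filter_upwards [hsmall] with t ht
  exact h _ _ ht (by rw [coshDist_hexp_self, mul_comm])

theorem dirDeriv_center (h : HasRadialProfile p r F k) (hr : 0 < r) (X : tangentSpace p) :
    dirDeriv F p X = tlen X * deriv k 0 := by
  rw [dirDeriv, (h.comp_hexp_center hr X).deriv_eq, deriv_comp_mul_left, mul_zero, smul_eq_mul]

theorem hessQuad_center (h : HasRadialProfile p r F k) (hr : 0 < r) (X : tangentSpace p) :
    hessQuad F p X = iteratedDeriv 2 k 0 * mink X.1 X.1 := by
  rw [hessQuad, (h.comp_hexp_center hr X).iteratedDeriv_eq 2, iteratedDeriv_two_comp_mul_left,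
    mul_zero, tlen_sq, mul_comm]

theorem laplaceBeltrami_center (h : HasRadialProfile p r F k) (hr : 0 < r) :
    laplaceBeltrami F p = n * iteratedDeriv 2 k 0 := by
  simp only [laplaceBeltrami_eq_sum, h.hessQuad_center hr, frame_orthonormal, if_true, mul_one,
    Finset.sum_const, Finset.card_univ, Fintype.card_fin, nsmul_eq_mul]

theorem eventuallyEq (h : HasRadialProfile p r F k) (hx : hdist p x < r) :
    F =ᶠ[𝓝 x] fun y => k (hdist p y) := by
  have hball : geodesicBall p r ∈ 𝓝 x := by
    have hr := (hdist_nonneg p x).trans_lt hx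
    rw [geodesicBall_eq p hr]
    refine (isOpen_coshDist_lt p _).mem_nhds ?_
    rwa [← geodesicBall_eq p hr]
  filter_upwards [hball] with y hy
  exact h y _ (by rwa [abs_of_nonneg (hdist_nonneg p y)]) (cosh_hdist p y)

theorem sum_dirDeriv_sq (h : HasRadialProfile p r F k) (hx : hdist p x < r) (hne : x ≠ p)
    (hk : DifferentiableAt ℝ k (hdist p x)) :
    ∑ i, dirDeriv F x (frame x i) ^ 2 = deriv k (hdist p x) ^ 2 := by
  simp only [dirDeriv_congr (h.eventuallyEq hx), dirDeriv_comp hk (isC2At_hdist hne), mul_pow,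
    ← Finset.mul_sum, sum_dirDeriv_hdist_sq hne, mul_one]

theorem hessQuad_eq (h : HasRadialProfile p r F k) (hx : hdist p x < r) (hne : x ≠ p)
    (hk : ContDiffAt ℝ 2 k (hdist p x)) (X : tangentSpace x) :
    hessQuad F x X =
      (iteratedDeriv 2 k (hdist p x) -
          deriv k (hdist p x) * (Real.cosh (hdist p x) / Real.sinh (hdist p x))) *
        dirDeriv (hdist p) x X ^ 2 +
      deriv k (hdist p x) * (Real.cosh (hdist p x) / Real.sinh (hdist p x)) * mink X.1 X.1 := by
  rw [hessQuad_congr (h.eventuallyEq hx), hessQuad_comp_hdist hne hk]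

theorem laplaceBeltrami_eq (h : HasRadialProfile p r F k) (hx : hdist p x < r) (hne : x ≠ p)
    (hk : ContDiffAt ℝ 2 k (hdist p x)) :
    laplaceBeltrami F x = iteratedDeriv 2 k (hdist p x) +
      (n - 1) * (Real.cosh (hdist p x) / Real.sinh (hdist p x)) * deriv k (hdist p x) := by
  simp only [laplaceBeltrami_eq_sum, h.hessQuad_eq hx hne hk, Finset.sum_add_distrib,
    ← Finset.mul_sum, sum_dirDeriv_hdist_sq hne, frame_orthonormal, if_true, Finset.sum_const,
    Finset.card_univ, Fintype.card_fin, nsmul_eq_mul]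
  ring

end HasRadialProfile

theorem hessQuad_log {v : Hyp n → ℝ} {x : Hyp n} (hv : IsC2At v x) (h0 : v x ≠ 0)
    (X : tangentSpace x) : hessQuad (fun y => Real.log (v y)) x X =
      hessQuad v x X / v x - dirDeriv (fun y => Real.log (v y)) x X ^ 2 := by
  have hlog : iteratedDeriv 2 Real.log (v x) = -(v x ^ 2)⁻¹ := by
    rw [iteratedDeriv_succ, iteratedDeriv_one, Real.deriv_log', deriv_inv]
  rw [hessQuad_comp (Real.contDiffAt_log.2 h0) hv, dirDeriv_comp (Real.differentiableAt_log h0) hv,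
    hlog, Real.deriv_log]
  field_simp
  ring

theorem laplaceBeltrami_log {v : Hyp n → ℝ} {x : Hyp n} (hv : IsC2At v x) (h0 : v x ≠ 0) :
    laplaceBeltrami (fun y => Real.log (v y)) x = laplaceBeltrami v x / v x -
      ∑ i, dirDeriv (fun y => Real.log (v y)) x (frame x i) ^ 2 := by
  simp only [laplaceBeltrami_eq_sum, hessQuad_log hv h0, Finset.sum_sub_distrib, Finset.sum_div]

namespace IsDirichletSolution

variable {p : Hyp n} {r μ : ℝ} {v : Hyp n → ℝ}

theorem laplaceBeltrami_log {S : ℝ} (hv : IsDirichletSolution p S μ v) {x : Hyp n}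
    (hx : coshDist p x < S) (h0 : v x ≠ 0) : laplaceBeltrami (fun y => Real.log (v y)) x =
      -μ - ∑ i, dirDeriv (fun y => Real.log (v y)) x (frame x i) ^ 2 := by
  rw [HypBall.laplaceBeltrami_log (hv.c2 x hx) h0, hv.eqn x hx, mul_div_cancel_right₀ _ h0]

theorem exists_hasRadialProfile_log (hv : IsDirichletSolution p (Real.cosh r) μ v) (hn : 1 ≤ n)
    (hr : 0 < r) (hμ : 0 ≤ μ) (hpos : ∀ x, coshDist p x < Real.cosh r → 0 < v x) :
    ∃ ℓ, HasRadialProfile p r (fun x => Real.log (v x)) ℓ ∧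
      ∀ ρ ∈ Ico 0 r, ContDiffAt ℝ 2 ℓ ρ := by
  obtain ⟨E, hE⟩ := exists_tlen_eq_one hn p
  have hlt : ∀ ρ, |ρ| < r → coshDist p (hexp p (ρ • E)) < Real.cosh r := fun ρ hρ => by
    rwa [coshDist_hexp_of_tlen_eq_one hE, Real.cosh_lt_cosh, abs_of_pos hr]
  refine ⟨fun ρ => Real.log (v (hexp p (ρ • E))), fun x ρ hρ hx => ?_, fun ρ hρ => ?_⟩
  · have hxρ : coshDist p x = coshDist p (hexp p (ρ • E)) := by
      rw [coshDist_hexp_of_tlen_eq_one hE, hx]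
    exact congrArg Real.log
      (hv.eq_of_coshDist_eq (Real.one_lt_cosh.2 hr.ne') hμ hpos hxρ (hxρ ▸ hlt ρ hρ))
  · have hρr := hlt ρ (by rw [abs_of_nonneg hρ.1]; exact hρ.2)
    exact (hv.c2 _ hρr).contDiffAt_comp_hexp.log (hpos _ hρr).ne'

theorem isLogProfile (hv : IsDirichletSolution p (Real.cosh r) μ v) (hn : 1 ≤ n) (hr : 0 < r)
    (hpos : ∀ x, coshDist p x < Real.cosh r → 0 < v x) {ℓ : ℝ → ℝ}
    (hℓ : HasRadialProfile p r (fun x => Real.log (v x)) ℓ)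
    (hcd : ∀ ρ ∈ Ico 0 r, ContDiffAt ℝ 2 ℓ ρ) : IsLogProfile (n - 1) μ r ℓ := by
  refine ⟨hcd, hℓ.deriv_zero hn hr, fun ρ hρ => ?_⟩
  obtain ⟨E, hE⟩ := exists_tlen_eq_one hn p
  set x := hexp p (ρ • E)
  have hxρ : hdist p x = ρ := hdist_hexp_of_tlen_eq_one hE hρ.1.le
  have hne : x ≠ p := by
    rintro hxp
    rw [hxp, hdist_self] at hxρ
    exact hρ.1.ne hxρ
  have hxr : hdist p x < r := hxρ ▸ hρ.2
  have hx : coshDist p x < Real.cosh r := by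
    rwa [← cosh_hdist, Real.cosh_lt_cosh, abs_of_nonneg (hdist_nonneg p x), abs_of_pos hr]
  have hℓρ : ContDiffAt ℝ 2 ℓ (hdist p x) := hxρ ▸ hcd ρ (Ioo_subset_Ico_self hρ)
  have hlap := hv.laplaceBeltrami_log hx (hpos x hx).ne'
  rwa [hℓ.laplaceBeltrami_eq hxr hne hℓρ,
    hℓ.sum_dirDeriv_sq hxr hne (hℓρ.differentiableAt two_ne_zero), hxρ,
    ← Nat.cast_pred hn] at hlap

end IsDirichletSolution

/-! ### Log-concavity -/

theorem hessMatrix_eq {f : Hyp n → ℝ} {x : Hyp n} {N : Mink n} {a b : ℝ}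
    (h : ∀ X : tangentSpace x, hessQuad f x X = a * mink N X.1 ^ 2 + b * mink X.1 X.1) :
    hessMatrix f x = a • Matrix.vecMulVec (fun i => mink N (frame x i).1)
      (fun i => mink N (frame x i).1) + b • (1 : Matrix (Fin n) (Fin n) ℝ) := by
  ext i j
  simp only [hessMatrix, Matrix.of_apply, hess, h, Submodule.coe_add, Submodule.coe_sub,
    mink_add_left, mink_add_right, mink_sub_left, mink_sub_right,
    mink_comm (frame x j).1 (frame x i).1, Matrix.add_apply, Matrix.smul_apply,
    Matrix.vecMulVec_apply, Matrix.one_apply, ← frame_orthonormal x i j, smul_eq_mul]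
  ring

theorem posDef_smul_vecMulVec_add_smul_one {ι : Type*} [Fintype ι] [DecidableEq ι] {ν : ι → ℝ}
    {a b : ℝ} (hb : 0 < b) (hab : 0 < a * (ν ⬝ᵥ ν) + b) :
    (a • Matrix.vecMulVec ν ν + b • (1 : Matrix ι ι ℝ)).PosDef := by
  refine Matrix.PosDef.of_dotProduct_mulVec_pos ?_ fun ξ hξ => ?_
  · ext i j
    simp only [Matrix.conjTranspose_apply, Matrix.add_apply, Matrix.smul_apply,
      Matrix.vecMulVec_apply, Matrix.one_apply, star_trivial, smul_eq_mul, eq_comm (a := j),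
      mul_comm (ν j)]
  · have hquad : star ξ ⬝ᵥ ((a • Matrix.vecMulVec ν ν + b • (1 : Matrix ι ι ℝ)).mulVec ξ) =
        a * (ν ⬝ᵥ ξ) ^ 2 + b * (ξ ⬝ᵥ ξ) := by
      simp only [Matrix.add_mulVec, Matrix.smul_mulVec, Matrix.one_mulVec,
        Matrix.vecMulVec_mulVec, star_trivial, dotProduct_add, dotProduct_smul, smul_eq_mul,
        op_smul_eq_smul, dotProduct_comm ξ ν, sq]
    have hξξ : 0 < ξ ⬝ᵥ ξ := Matrix.dotProduct_star_self_pos_iff.2 hξ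
    have hcauchy : (ν ⬝ᵥ ξ) ^ 2 ≤ (ν ⬝ᵥ ν) * (ξ ⬝ᵥ ξ) := by
      simpa only [dotProduct, sq] using Finset.sum_mul_sq_le_sq_mul_sq Finset.univ ν ξ
    rw [hquad]
    rcases le_or_gt 0 a with ha | ha
    · positivity
    · nlinarith [mul_pos hab hξξ]

theorem posDef_neg_hessMatrix_sub {f : Hyp n → ℝ} {x : Hyp n} {N : Mink n} {a b c : ℝ}
    (h : ∀ X : tangentSpace x, hessQuad f x X = a * mink N X.1 ^ 2 + b * mink X.1 X.1)
    (hb : b + c < 0) (hab : a * ∑ i, mink N (frame x i).1 ^ 2 + b + c < 0) :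
    (-hessMatrix f x - c • (1 : Matrix (Fin n) (Fin n) ℝ)).PosDef := by
  have hneg := posDef_smul_vecMulVec_add_smul_one (ν := fun i => mink N (frame x i).1) (a := -a)
    (neg_pos.2 hb) (by simp only [dotProduct, ← sq]; linarith)
  convert hneg using 1
  rw [hessMatrix_eq h]
  module

theorem HasRadialProfile.posDef_center {p : Hyp n} {r : ℝ} {F : Hyp n → ℝ} {k : ℝ → ℝ}
    (h : HasRadialProfile p r F k) (hr : 0 < r) (hk' : deriv k 0 = 0)
    (hk'' : iteratedDeriv 2 k 0 < 0) :
    (-hessMatrix F p - gradNorm F p • (1 : Matrix (Fin n) (Fin n) ℝ)).PosDef := by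
  have hgrad : gradNorm F p = 0 := by
    simp only [gradNorm, h.dirDeriv_center hr, hk', mul_zero, zero_pow two_ne_zero,
      Finset.sum_const_zero, Real.sqrt_zero]
  refine posDef_neg_hessMatrix_sub (N := 0) (a := 0) (b := iteratedDeriv 2 k 0) (fun X => ?_) ?_ ?_
  · rw [zero_mul, zero_add, h.hessQuad_center hr]
  · rwa [hgrad, add_zero]
  · rwa [hgrad, add_zero, zero_mul, zero_add]

/-- The eigenvalues of the Hessian are `k''` in the radial direction and `k' coth` across it, and
the gradient has length `-k'`. -/
theorem HasRadialProfile.posDef_of_ne_center {p x : Hyp n} {r : ℝ} {F : Hyp n → ℝ} {k : ℝ → ℝ}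
    (h : HasRadialProfile p r F k) (hx : hdist p x < r) (hne : x ≠ p)
    (hk : ContDiffAt ℝ 2 k (hdist p x)) (hk' : deriv k (hdist p x) < 0)
    (hk'' : iteratedDeriv 2 k (hdist p x) < deriv k (hdist p x)) :
    (-hessMatrix F x - gradNorm F x • (1 : Matrix (Fin n) (Fin n) ℝ)).PosDef := by
  have hgrad : gradNorm F x = -deriv k (hdist p x) := by
    rw [gradNorm, h.sum_dirDeriv_sq hx hne (hk.differentiableAt two_ne_zero), Real.sqrt_sq_eq_abs,
      abs_of_neg hk']
  have hdir : ∀ X : tangentSpace x,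
      mink (-(Real.sinh (hdist p x))⁻¹ • p.1) X.1 = dirDeriv (hdist p) x X := fun X => by
    rw [mink_smul_left, dirDeriv_hdist hne, neg_mul, ← div_eq_inv_mul, neg_div]
  refine posDef_neg_hessMatrix_sub (fun X => by rw [h.hessQuad_eq hx hne hk, hdir]) ?_ ?_
  · have hcoth : 1 < Real.cosh (hdist p x) / Real.sinh (hdist p x) :=
      (one_lt_div (Real.sinh_pos_iff.2 (hdist_pos hne))).2 (Real.sinh_lt_cosh _)
    rw [hgrad]
    nlinarith
  · simp only [hdir, sum_dirDeriv_hdist_sq hne, hgrad]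
    linarith

theorem IsDirichletSolution.strictlyLogConcaveOn {p : Hyp n} {r μ : ℝ} {v : Hyp n → ℝ}
    (hv : IsDirichletSolution p (Real.cosh r) μ v) (hn : 1 ≤ n) (hr : 0 < r)
    (hsinh : Real.sinh r ≤ 1 / 2) (hμ : n ≤ μ)
    (hpos : ∀ x, coshDist p x < Real.cosh r → 0 < v x) :
    StrictlyLogConcaveOn 1 v (geodesicBall p r) := by
  have hn0 : (0 : ℝ) < n := Nat.cast_pos.2 hn
  have hμ0 : 0 < μ := hn0.trans_le hμ
  obtain ⟨ℓ, hℓ, hcd⟩ := hv.exists_hasRadialProfile_log hn hr hμ0.le hpos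
  have hprofile := hv.isLogProfile hn hr hpos hℓ hcd
  intro x hx
  have hxS : coshDist p x < Real.cosh r := by rwa [geodesicBall_eq p hr] at hx
  refine ⟨hpos x hxS, ?_⟩
  rw [one_mul]
  rcases eq_or_ne x p with rfl | hne
  · have hℓ' := hℓ.deriv_zero hn hr
    have hlap := hv.laplaceBeltrami_log hxS (hpos x hxS).ne'
    simp only [hℓ.laplaceBeltrami_center hr, hℓ.dirDeriv_center hr, hℓ', mul_zero,
      zero_pow two_ne_zero, Finset.sum_const_zero, sub_zero] at hlap
    exact hℓ.posDef_center hr hℓ' (neg_of_mul_neg_right (hlap ▸ neg_lt_zero.2 hμ0) hn0.le)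
  · have hρ : hdist p x ∈ Ioo 0 r := ⟨hdist_pos hne, hx⟩
    refine hℓ.posDef_of_ne_center hx hne (hcd _ (Ioo_subset_Ico_self hρ))
      (hprofile.deriv_neg hμ0 hρ) (hprofile.iteratedDeriv_two_lt_deriv ?_ hsinh hρ)
    rwa [Nat.cast_pred hn, sub_add_cancel]

end HypBall

open HypBall in
theorem lemma2p1_general {n : ℕ} (hn : 1 ≤ n) {p : Hyp n} {r : ℝ} (hr : 0 < r)
    (hsinh : Real.sinh r ≤ 1 / 2) {μ : ℝ} {v : Hyp n → ℝ}
    (hv : IsDirichletEigenfunction (geodesicBall p r) μ v)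
    (hpos : ∀ x ∈ geodesicBall p r, 0 < v x) : StrictlyLogConcaveOn 1 v (geodesicBall p r) := by
  have hsol := hv.isDirichletSolution hr
  rw [geodesicBall_eq p hr] at hpos
  have hcosh : Real.cosh r < 2 := by
    nlinarith [Real.cosh_sq r, Real.sinh_pos_iff.2 hr]
  have hμ := hsol.le_eigenvalue_mul (Real.one_lt_cosh.2 hr.ne') hpos hcosh
  exact hsol.strictlyLogConcaveOn hn hr hsinh (by linarith) hpos

theorem lemma2p1 (n : ℕ) (hn : 1 ≤ n) :
    ∃ r₀ : ℝ, 0 < r₀ ∧ ∀ (p : HypBall.Hyp n) (r : ℝ), 0 < r → r < r₀ →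
      ∀ v : HypBall.Hyp n → ℝ,
        HypBall.IsFirstEigenfunction (HypBall.geodesicBall p r) v →
          HypBall.StrictlyLogConcaveOn 1 v (HypBall.geodesicBall p r) := by
  refine ⟨Real.arsinh (1 / 2), Real.arsinh_pos_iff.2 one_half_pos, ?_⟩
  rintro p r hr hr₀ v ⟨μ, -, hv, hpos⟩
  have hsinh : Real.sinh r ≤ 1 / 2 := Real.sinh_arsinh (1 / 2) ▸ Real.sinh_le_sinh.2 hr₀.le
  exact lemma2p1_general hn hr hsinh hv hpos
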